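/- Let $n\ge 1$, write points of $\mathbb P^{2n+1}$ over $\mathbb C$ as $[z':z'']$ with $z',z''\in\mathbb C^{n+1}$, let $\|\cdot\|$ be the Hermitian norm on $\mathbb C^{n+1}$ and the corresponding operator norm on $M_{n+1}(\mathbb C)$, and call $n$-dimensional projective linear subspaces $n$-planes. *Type L.* For $A\in GL_{2n+2}(\mathbb C)$ let $\hat A$ be the matrix of its $(n+1)\times(n+1)$ minors, i.e. the induced map on $\Lambda^{n+1}\mathbb C^{2n+2}$. Let $\Gamma\subset PGL_{2n+2}(\mathbb C)$ be a subgroup. A sequence $(\sigma_\nu)$ of distinct elements of $\Gamma$ is normal if representatives of the $\sigma_\nu$ and of the $\hat\sigma_\nu$ can be chosen whose largest entry has absolute value $1$ and which converge, to $T$ and $S$ say. An $n$-plane is a limit $n$-plane of $\Gamma$ if its Plücker point lies in the projectivized image of $S$ for some normal sequence of $\Gamma$. $\Omega(\Gamma)$ is the complement in $\mathbb P^{2n+1}$ of the union of all limit $n$-planes. $\Gamma$ is of type L if it is discrete and $\Omega(\Gamma)$ contains a domain that contains an $n$-plane. *Conditions on the coordinates.* Represent $g\in PGL_{2n+2}(\mathbb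 C)$ by $\begin{pmatrix}A_g&B_g\\C_g&D_g\end{pmatrix}\in SL_{2n+2}(\mathbb C)$ with blocks of size $n+1$, and put $\Gamma^*=\Gamma\setminus\{1\}$. The coordinates are admissible for $\Gamma$ if for some $R>0$ the set $V_R=\{\|z'\|>R\|z''\|\}$ lies in $\Omega(\Gamma)$ and $g(V_R)\cap V_R=\emptyset$ for all $g\in\Gamma^*$ (then $\det C_g\ne0$ for $g\in\Gamma^*$). $(\clubsuit)$: the numbers $\|C_g^{-1}\|$, $g\in\Gamma^*$, are bounded. $(\spadesuit)$: the family $(\|C_g^{-1}\|)_{g\in\Gamma^*}$ has no accumulation point other than $0$, i.e. each $x\neq 0$ has a neighbourhood that contains $\|C_g^{-1}\|$ for only finitely many $g\in\Gamma^*$. The $F$-region of $\Gamma$ is the interior of $\bigcap_{g\in\Gamma^*}\{\|z''\|\le\|C_gz'+D_gz''\|\}$. *Combination.* Let $\Gamma_1,\Gamma_2\subset PGL_{2n+2}(\mathbb C)$ be type L groups for which the coordinates are admissible and which satisfy $(\clubsuit)$ and $(\spadesuit)$; let $F_1,F_2$ be their $F$-regions. Put $$\alpha_a=\begin{pmatrix}aI&0\\0&a^{-1}I\end{pmatrix}\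 (a>0),\quad \sigma=\begin{pmatrix}0&I\\I&0\end{pmatrix},\quad \tau=\begin{pmatrix}I&I\\-I&I\end{pmatrix},$$ $$K_r=\sup_{\|X\|\le r,\ \|Y\|\le r}\left\|\left((I+X)(I-X)^{-1}+(I+Y)(I-Y)^{-1}\right)^{-1}\right\|\quad(0<r<1).$$ Call $a>0$ suitable for $r>0$ if $\{\|z'\|\ge r\|z''\|\}\subset\alpha_a(F_1\cap F_2)$ and $\|C_g^{-1}\|\le1$ for all $g\ne1$ in $\alpha_a\Gamma_1\alpha_a^{-1}$ and in $\alpha_a\Gamma_2\alpha_a^{-1}$. **Theorem 6.1.** $\lim_{r\to0+}K_r=\tfrac12$, and for every $r>0$ there is a suitable $a>0$. Let $0<r<1$, let $a$ be suitable for $r$, put $\Gamma_1'=\tau\alpha_a\Gamma_1\alpha_a^{-1}\tau^{-1}$ and $\Gamma_2'=\tau\sigma\alpha_a\Gamma_2\alpha_a^{-1}\sigma^{-1}\tau^{-1}$, and let $\Gamma$ be the group generated by $\Gamma_1'$ and $\Gamma_2'$. Then: 1. $\Gamma$ is the free product of $\Gamma_1'$ and $\Gamma_2'$. 2. Let $f=g_m\cdots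 g_1$ with $m\ge1$, where the $g_j\neq1$ are taken alternately from $\Gamma_1'$ and $\Gamma_2'$. Then $C_f$ and all $C_{g_j}$ are invertible and $\|C_f^{-1}\|\le K_r^{\,m-1}\prod_{j=1}^m\|C_{g_j}^{-1}\|$. 3. If $K_r<1$ (which holds for all small $r$), then $\Gamma$ is of type L, the coordinates are admissible for $\Gamma$, and $\Gamma$ satisfies $(\clubsuit)$ and $(\spadesuit)$. Here the blocks of elements of $\Gamma,\Gamma_1',\Gamma_2'$ are those of the conjugated groups as written above, that is, they are taken with respect to the new coordinates $[w]=\tau([z])$. -/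

import Mathlib

open Filter Topology
open scoped LinearAlgebra.Projectivization

noncomputable section

namespace TypeLGroup

/-! ### Projective space, the projective linear group and their topologies -/

/-- Index set of the homogeneous coordinates `[z' : z'']` of `ℙ^{2n+1}`: the left summand indexes
`z' = (z_0, …, z_n)`, the right one `z'' = (z_{n+1}, …, z_{2n+1})`. -/
abbrev Idx (n : ℕ) : Type := Fin (n + 1) ⊕ Fin (n + 1)

/-- Complex square matrices of size `n + 1`. -/
abbrev Blk (n : ℕ) : Type := Matrix (Fin (n + 1)) (Fin (n + 1)) ℂ

/-- The projective space `ℙ^{2n+1}` over `ℂ`. -/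
abbrev PSpace (n : ℕ) : Type := ℙ ℂ (Idx n → ℂ)

/-- The group `PGL_{2n+2}(ℂ)`; it acts on `PSpace n` by Mathlib's action. -/
abbrev PGLGroup (n : ℕ) : Type := Matrix.ProjGenLinGroup (Idx n) ℂ

/-- The quotient topology of `ℂ^{2n+2} ∖ {0}` on projective space. -/
instance instTopologicalSpacePSpace (n : ℕ) : TopologicalSpace (PSpace n) :=
  TopologicalSpace.coinduced
    (Projectivization.mk' ℂ : {v : Idx n → ℂ // v ≠ 0} → PSpace n) inferInstance

/-- The quotient topology of `GL_{2n+2}(ℂ)` on `PGL_{2n+2}(ℂ)`. -/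
instance instTopologicalSpacePGLGroup (n : ℕ) : TopologicalSpace (PGLGroup n) :=
  TopologicalSpace.coinduced
    (Matrix.ProjGenLinGroup.mk : Matrix.GeneralLinearGroup (Idx n) ℂ → PGLGroup n) inferInstance

/-- The set of points of the projective linear subspace given by a linear subspace `X`.
An `n`-plane is a linear subspace `X` with `Module.finrank ℂ X = n + 1`. -/
def support {n : ℕ} (X : Submodule ℂ (Idx n → ℂ)) : Set (PSpace n) :=
  {p | p.submodule ≤ X}

/-! ### Norms -/

/-- The Hermitian norm `‖u‖ = (|u_1|² + … + |u_m|²)^{1/2}`. -/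
def vnorm {ι : Type*} [Fintype ι] (u : ι → ℂ) : ℝ :=
  ‖(WithLp.toLp 2 u : EuclideanSpace ℂ ι)‖

/-- The operator norm of a square matrix with respect to the Hermitian norm. -/
def opNorm {ι : Type*} [Fintype ι] [DecidableEq ι] (A : Matrix ι ι ℂ) : ℝ :=
  ‖Matrix.toEuclideanCLM (n := ι) (𝕜 := ℂ) A‖

/-- The maximum `|A|` of the absolute values of the entries of a matrix (the norm of a finite
product is the maximum of the norms of the components). -/
def entryNorm {κ : Type*} [Fintype κ] (A : Matrix κ κ ℂ) : ℝ :=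
  ‖(fun i j => A i j : κ → κ → ℂ)‖

/-! ### Plücker coordinates, limit planes, set of discontinuity, type L -/

/-- Increasing multiindices `i_1 < … < i_{n+1}` in the set of the `2n + 2` coordinates, where the
coordinates are ordered as `z_0, …, z_{2n+1}`. -/
abbrev MultiIdx (n : ℕ) : Type :=
  {I : Fin (n + 1) → Idx n // StrictMono fun k => toLex (I k)}

instance instFintypeMultiIdx (n : ℕ) : Fintype (MultiIdx n) := Fintype.ofFinite _

/-- The matrix `Â` of all minors of size `n + 1` of `A`: the matrix of the map that `A` induces on
the space of `(n+1)`-vectors. Row index `K`, column index `J`. -/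
def compound {n : ℕ} (A : Matrix (Idx n) (Idx n) ℂ) : Matrix (MultiIdx n) (MultiIdx n) ℂ :=
  Matrix.of fun K J => (A.submatrix K.1 J.1).det

/-- The Plücker coordinates of `x_1 ∧ … ∧ x_{n+1}`. -/
def pluecker {n : ℕ} (x : Fin (n + 1) → Idx n → ℂ) : MultiIdx n → ℂ :=
  fun K => (Matrix.of fun i j => x j (K.1 i)).det

/-- After multiplication of each `A ν` by a suitable scalar, the matrices have `|A ν| = 1` and
converge to `L`. -/
def NormalizedLimit {κ : Type*} [Fintype κ] (A : ℕ → Matrix κ κ ℂ) (L : Matrix κ κ ℂ) : Prop :=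
  ∃ c : ℕ → ℂ, (∀ ν, entryNorm (c ν • A ν) = 1) ∧ Tendsto (fun ν => c ν • A ν) atTop (𝓝 L)

/-- `X` is a limit `n`-plane of `Γ`: there is a normal sequence of `Γ`, that is, a sequence of
distinct elements (given by representatives `s ν`) such that both `s ν` and the induced maps on
`(n+1)`-vectors converge after normalization, and the Plücker point of `X` lies in the limit image
of the latter. -/
def IsLimitPlane {n : ℕ} (Γ : Subgroup (PGLGroup n)) (X : Submodule ℂ (Idx n → ℂ)) : Prop :=
  ∃ s : ℕ → Matrix.GeneralLinearGroup (Idx n) ℂ,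
    (∀ ν, Matrix.ProjGenLinGroup.mk (s ν) ∈ Γ) ∧
    (Function.Injective fun ν => Matrix.ProjGenLinGroup.mk (s ν)) ∧
    (∃ T, NormalizedLimit (fun ν => (s ν : Matrix (Idx n) (Idx n) ℂ)) T) ∧
    ∃ S, NormalizedLimit (fun ν => compound (s ν : Matrix (Idx n) (Idx n) ℂ)) S ∧
      ∃ b : Module.Basis (Fin (n + 1)) ℂ X,
        pluecker (fun j => (b j : Idx n → ℂ)) ∈ LinearMap.range S.mulVecLin

/-- The limit set `Λ(Γ)`: the union of the limit `n`-planes. -/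
def limitSet {n : ℕ} (Γ : Subgroup (PGLGroup n)) : Set (PSpace n) :=
  ⋃ (X : Submodule ℂ (Idx n → ℂ)) (_ : IsLimitPlane Γ X), support X

/-- The set of discontinuity `Ω(Γ) = ℙ^{2n+1} ∖ Λ(Γ)`. -/
def discontinuitySet {n : ℕ} (Γ : Subgroup (PGLGroup n)) : Set (PSpace n) :=
  (limitSet Γ)ᶜ

/-- A large domain: a non-empty connected open set that contains an `n`-plane. -/
def IsLargeDomain {n : ℕ} (U : Set (PSpace n)) : Prop :=
  IsOpen U ∧ IsConnected U ∧
    ∃ X : Submodule ℂ (Idx n → ℂ), Module.finrank ℂ X = n + 1 ∧ support X ⊆ U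

/-- A type L group: a discrete subgroup whose set of discontinuity contains a large domain. -/
def IsTypeL {n : ℕ} (Γ : Subgroup (PGLGroup n)) : Prop :=
  DiscreteTopology Γ ∧ ∃ U, IsLargeDomain U ∧ U ⊆ discontinuitySet Γ

/-! ### The blocks of an element with respect to `[z' : z'']` -/

/-- Every element of `PGL_{2n+2}(ℂ)` has a representative of determinant one. -/
theorem exists_slRep {n : ℕ} (g : PGLGroup n) :
    ∃ M : Matrix.SpecialLinearGroup (Idx n) ℂ, Matrix.SpecialLinearGroup.toPGL M = g := by
  obtain ⟨x, hx⟩ := Matrix.ProjectiveSpecialLinearGroup.toPGL_surj_of_roots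
    (n := Idx n) (R := ℂ) (fun r => by
      obtain ⟨x, hx⟩ := IsAlgClosed.exists_pow_nat_eq (r : ℂ)
        (Fintype.card_pos : 0 < Fintype.card (Idx n))
      have hx0 : x ≠ 0 := by
        rintro rfl
        rw [zero_pow Fintype.card_ne_zero] at hx
        exact r.ne_zero hx.symm
      exact ⟨Units.mk0 x hx0, Units.ext (by simpa using hx)⟩) g
  obtain ⟨M, rfl⟩ := QuotientGroup.mk_surjective x
  exact ⟨M, by simpa using hx⟩

/-- A representative of `g` in `SL_{2n+2}(ℂ)`. It is unique up to a root of unity, so that the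
quantities `‖C_g⁻¹‖` and `‖C_g z' + D_g z''‖` do not depend on the choice. -/
def slRep {n : ℕ} (g : PGLGroup n) : Matrix (Idx n) (Idx n) ℂ :=
  ((exists_slRep g).choose : Matrix (Idx n) (Idx n) ℂ)

/-- The lower left block `C_g`. -/
def blockC {n : ℕ} (g : PGLGroup n) : Blk n := (slRep g).toBlocks₂₁

/-- The lower right block `D_g`. -/
def blockD {n : ℕ} (g : PGLGroup n) : Blk n := (slRep g).toBlocks₂₂

/-- The number `‖C_g⁻¹‖`. -/
def radius {n : ℕ} (g : PGLGroup n) : ℝ := opNorm ((blockC g)⁻¹)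

/-- `‖z'‖` for the chosen homogeneous coordinates of a point. All conditions below are homogeneous
in `z`, hence independent of that choice. -/
def fstNorm {n : ℕ} (p : PSpace n) : ℝ := vnorm fun i => p.rep (Sum.inl i)

/-- `‖z''‖` for the chosen homogeneous coordinates of a point. -/
def sndNorm {n : ℕ} (p : PSpace n) : ℝ := vnorm fun i => p.rep (Sum.inr i)

/-- `V_R = {‖z'‖ > R ‖z''‖}`, a neighbourhood of the `n`-plane `z'' = 0`. -/
def tube {n : ℕ} (R : ℝ) : Set (PSpace n) := {p | R * sndNorm p < fstNorm p}

/-- The standing condition on the homogeneous coordinates: for some `R > 0`, the set `V_R` lies in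
`Ω(Γ)` and is disjoint from its images under all `g ≠ 1` in `Γ`. It implies that `C_g` is
invertible for `g ≠ 1`. -/
def AdmissibleCoordinates {n : ℕ} (Γ : Subgroup (PGLGroup n)) : Prop :=
  ∃ R : ℝ, 0 < R ∧ tube R ⊆ discontinuitySet Γ ∧
    ∀ g ∈ Γ, g ≠ 1 → Disjoint ((fun p : PSpace n => g • p) '' tube R) (tube R)

/-- Condition (♣): the numbers `‖C_g⁻¹‖`, `g ∈ Γ ∖ {1}`, are bounded. -/
def Club {n : ℕ} (Γ : Subgroup (PGLGroup n)) : Prop :=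
  ∃ b : ℝ, ∀ g ∈ Γ, g ≠ 1 → radius g ≤ b

/-- Condition (♠): the numbers `‖C_g⁻¹‖`, `g ∈ Γ ∖ {1}`, do not accumulate at any `x ≠ 0`, where
a value taken by infinitely many `g` counts as a point of accumulation. -/
def Spade {n : ℕ} (Γ : Subgroup (PGLGroup n)) : Prop :=
  ∀ x : ℝ, x ≠ 0 → ∃ ε : ℝ, 0 < ε ∧ {g | g ∈ Γ ∧ g ≠ 1 ∧ |radius g - x| < ε}.Finite

/-- The set `Δ̄_g = {‖z''‖ ≤ ‖C_g z' + D_g z''‖}`. -/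
def deltaBar {n : ℕ} (g : PGLGroup n) : Set (PSpace n) :=
  {p | sndNorm p ≤ vnorm ((blockC g).mulVec (fun i => p.rep (Sum.inl i)) +
    (blockD g).mulVec (fun i => p.rep (Sum.inr i)))}

/-- The `F`-region of `Γ`: the interior of the intersection of all `Δ̄_g`, `g ∈ Γ ∖ {1}`. -/
def fRegion {n : ℕ} (Γ : Subgroup (PGLGroup n)) : Set (PSpace n) :=
  interior (⋂ g ∈ {g | g ∈ Γ ∧ g ≠ 1}, deltaBar g)

/-! ### The conjugations and the combination -/

/-- The element of `PGL_{2n+2}(ℂ)` of an invertible matrix. -/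
def ofInverse {n : ℕ} (M N : Matrix (Idx n) (Idx n) ℂ) (h₁ : M * N = 1) (h₂ : N * M = 1) :
    PGLGroup n :=
  Matrix.ProjGenLinGroup.mk ⟨M, N, h₁, h₂⟩

/-- The rescaling `α = (aI 0; 0 a⁻¹I)`, `a > 0`. -/
def alpha (n : ℕ) (a : ℝ) (ha : 0 < a) : PGLGroup n :=
  have h : (a : ℂ) ≠ 0 := Complex.ofReal_ne_zero.mpr ha.ne'
  ofInverse
    (Matrix.fromBlocks ((a : ℂ) • (1 : Blk n)) 0 0 ((a : ℂ)⁻¹ • (1 : Blk n)))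
    (Matrix.fromBlocks ((a : ℂ)⁻¹ • (1 : Blk n)) 0 0 ((a : ℂ) • (1 : Blk n)))
    (by
      rw [Matrix.fromBlocks_multiply]
      simp only [smul_mul_smul_comm, mul_inv_cancel₀ h, inv_mul_cancel₀ h, mul_zero, zero_mul,
        add_zero, zero_add, one_smul, mul_one, Matrix.fromBlocks_one])
    (by
      rw [Matrix.fromBlocks_multiply]
      simp only [smul_mul_smul_comm, mul_inv_cancel₀ h, inv_mul_cancel₀ h, mul_zero, zero_mul,
        add_zero, zero_add, one_smul, mul_one, Matrix.fromBlocks_one])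

/-- The swap `σ = (0 I; I 0)`. -/
def sigma (n : ℕ) : PGLGroup n :=
  ofInverse
    (Matrix.fromBlocks (0 : Blk n) 1 1 0)
    (Matrix.fromBlocks (0 : Blk n) 1 1 0)
    (by simp [Matrix.fromBlocks_multiply])
    (by simp [Matrix.fromBlocks_multiply])

/-- The transformation `τ = (I I; -I I)`. -/
def tau (n : ℕ) : PGLGroup n :=
  ofInverse
    (Matrix.fromBlocks (1 : Blk n) 1 (-1) 1)
    ((2 : ℂ)⁻¹ • Matrix.fromBlocks (1 : Blk n) (-1) 1 1)
    (by
      rw [Matrix.mul_smul, Matrix.fromBlocks_multiply]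
      simp [← two_smul ℂ (1 : Blk n), Matrix.fromBlocks_smul, smul_smul])
    (by
      rw [Matrix.smul_mul, Matrix.fromBlocks_multiply]
      simp [← two_smul ℂ (1 : Blk n), Matrix.fromBlocks_smul, smul_smul])

/-- The conjugate subgroup `x Γ x⁻¹`. -/
def conj {n : ℕ} (x : PGLGroup n) (Γ : Subgroup (PGLGroup n)) : Subgroup (PGLGroup n) :=
  Γ.map (MulAut.conj x).toMonoidHom

/-- The rescaling by `a` is suitable for `r`: `α(F₁ ∩ F₂)` contains `{‖z'‖ ≥ r ‖z''‖}`, and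
`‖C_g⁻¹‖ ≤ 1` for all `g ≠ 1` in `α Γ₁ α⁻¹` and in `α Γ₂ α⁻¹`. -/
def Suitable {n : ℕ} (Γ₁ Γ₂ : Subgroup (PGLGroup n)) (r a : ℝ) (ha : 0 < a) : Prop :=
  {p : PSpace n | r * sndNorm p ≤ fstNorm p} ⊆
      (fun p : PSpace n => alpha n a ha • p) '' (fRegion Γ₁ ∩ fRegion Γ₂) ∧
    (∀ g ∈ conj (alpha n a ha) Γ₁, g ≠ 1 → radius g ≤ 1) ∧
    ∀ g ∈ conj (alpha n a ha) Γ₂, g ≠ 1 → radius g ≤ 1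

/-- `Γ₁' = τ (α Γ₁ α⁻¹) τ⁻¹`. -/
def firstFactor {n : ℕ} (Γ₁ : Subgroup (PGLGroup n)) (a : ℝ) (ha : 0 < a) :
    Subgroup (PGLGroup n) :=
  conj (tau n) (conj (alpha n a ha) Γ₁)

/-- `Γ₂' = τ (σ (α Γ₂ α⁻¹) σ⁻¹) τ⁻¹`. -/
def secondFactor {n : ℕ} (Γ₂ : Subgroup (PGLGroup n)) (a : ℝ) (ha : 0 < a) :
    Subgroup (PGLGroup n) :=
  conj (tau n) (conj (sigma n) (conj (alpha n a ha) Γ₂))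

/-- `K_r`, the supremum of `‖((I+X)(I-X)⁻¹ + (I+Y)(I-Y)⁻¹)⁻¹‖` over `‖X‖ ≤ r`, `‖Y‖ ≤ r`. -/
def combConst (n : ℕ) (r : ℝ) : ℝ :=
  sSup {t | ∃ X Y : Blk n, opNorm X ≤ r ∧ opNorm Y ≤ r ∧
    t = opNorm (((1 + X) * (1 - X)⁻¹ + (1 + Y) * (1 - Y)⁻¹)⁻¹)}

/-- `G` is the (internal) free product of its subgroups `H₁` and `H₂`: the canonical homomorphism
from the free product is injective with image `G`. -/
def IsInternalFreeProduct {G₀ : Type*} [Group G₀] (H₁ H₂ G : Subgroup G₀) : Prop :=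
  Function.Injective (Monoid.Coprod.lift H₁.subtype H₂.subtype) ∧
    (Monoid.Coprod.lift H₁.subtype H₂.subtype).range = G

/-- The list `[g_m, …, g_1]` is a normal form: it is not empty, and its entries are elements other
than `1` taken alternately from `H₁` and `H₂`. -/
def IsNormalForm {G₀ : Type*} [Group G₀] (H₁ H₂ : Subgroup G₀) (l : List G₀) : Prop :=
  l ≠ [] ∧ (∀ g ∈ l, g ≠ 1 ∧ (g ∈ H₁ ∨ g ∈ H₂)) ∧
    l.IsChain fun g h => (g ∈ H₁ ∧ h ∈ H₂) ∨ (g ∈ H₂ ∧ h ∈ H₁)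

end TypeLGroup

end

open TypeLGroup

/-! The argument is ping-pong in the coordinates `z` before `τ`, where `w' = z' + z''` and `w'' =
z'' - z'`. By the definition of the `F`-region, an element `g ≠ 1` of the rescaled first group
satisfies `‖z''‖ ≤ ‖C z' + D z''‖` near every point with `‖z'‖ ≥ r‖z''‖`. This forces `‖C⁻¹‖ ≤ r`
and `‖C⁻¹D‖ ≤ r`, and `g` maps `{‖z'‖ ≥ r‖z''‖}` into `{‖z'‖ < r‖z''‖}` (`ExpandsTube.maps`,
`isLetter_conj_alpha`). The second group behaves in the same way with `z'` and `z''` exchanged.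
Hence an alternating word maps the region where both ratios of `‖z'‖` and `‖z''‖` are at least `r`
to a place where the part belonging to its leftmost letter dominates.

That region contains the plane `w'' = 0`, i.e. `z' = z''`. Its image under a word `f` is the graph
of a matrix `X` with `‖X‖ ≤ r`, over `z''` or over `z'`. In the coordinates `w` this says that `C_f`
is invertible and that `A_f C_f⁻¹` is plus or minus the Cayley transform `(1 + X)(1 - X)⁻¹`. Since
`C` vanishes for the identity, no word is trivial, and the product is free. For the norm estimate,
write `C_{gh} = C_g (A_h C_h⁻¹ + C_g⁻¹ D_g) C_h` with `C_g⁻¹ D_g = -A_{g⁻¹} C_{g⁻¹}⁻¹`. As `g` and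
the first letter of `h` lie in different factors, the bracket is, up to sign, a sum of two Cayley
transforms (`radius_mul_le`). The real part of each is at least `(1 - r)/(1 + r)`, whence `K_r = (1
+ r)/(2(1 - r))` exactly.

For the third claim the sizes are followed in the coordinates `z`, where a letter has size at most
`r`: each letter costs a factor `size/(1 - r²)`, and `K_r < 1` makes `r/(1 - r²) < 1`. So only
finitely many elements have `‖C_f⁻¹‖ ≥ ε` (`finite_le_radius`), which gives (♠). With `R = (1 +
r)/(1 - r)` every element other than `1` moves `V_R` off itself, which gives discreteness. Finally,
the minors of `f`, divided by `det C_f`, depend continuously on `C⁻¹`, `AC⁻¹`, `C⁻¹D` and `AC⁻¹D -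
B`. The first and the last tend to `0` along distinct elements, so every limit has rank one and its
image is the Plücker point of a graph `w' = X₀ w''` with `‖X₀‖ ≤ R`. Such a plane misses `V_R`. -/

noncomputable section

namespace TypeLGroup

/-! ### Norms -/

section Norms

variable {ι : Type*} [Fintype ι]

theorem vnorm_nonneg (u : ι → ℂ) : 0 ≤ vnorm u := norm_nonneg _

@[simp] theorem vnorm_zero : vnorm (0 : ι → ℂ) = 0 := by simp [vnorm]

theorem vnorm_eq_zero {u : ι → ℂ} : vnorm u = 0 ↔ u = 0 := by simp [vnorm]

theorem vnorm_pos {u : ι → ℂ} (h : u ≠ 0) : 0 < vnorm u :=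
  (vnorm_nonneg u).lt_of_ne fun h' => h (vnorm_eq_zero.1 h'.symm)

theorem vnorm_smul (c : ℂ) (u : ι → ℂ) : vnorm (c • u) = ‖c‖ * vnorm u := by
  simp [vnorm, norm_smul]

@[simp] theorem vnorm_neg (u : ι → ℂ) : vnorm (-u) = vnorm u := by simp [vnorm]

theorem vnorm_add_le (u v : ι → ℂ) : vnorm (u + v) ≤ vnorm u + vnorm v := by
  simpa [vnorm] using norm_add_le (WithLp.toLp 2 u) (WithLp.toLp 2 v)

theorem vnorm_sub_le (u v : ι → ℂ) : vnorm (u - v) ≤ vnorm u + vnorm v := by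
  simpa [vnorm] using norm_sub_le (WithLp.toLp 2 u) (WithLp.toLp 2 v)

theorem vnorm_sub_vnorm_le (u v : ι → ℂ) : vnorm u - vnorm v ≤ vnorm (u + v) := by
  have := vnorm_sub_le (u + v) v
  rw [add_sub_cancel_right] at this
  linarith

@[fun_prop]
theorem continuous_vnorm : Continuous (vnorm : (ι → ℂ) → ℝ) :=
  continuous_norm.comp (PiLp.continuous_toLp 2 _)

theorem norm_entry_le_vnorm (u : ι → ℂ) (i : ι) : ‖u i‖ ≤ vnorm u :=
  PiLp.norm_apply_le (WithLp.toLp 2 u) i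

variable [DecidableEq ι]

theorem opNorm_nonneg (A : Matrix ι ι ℂ) : 0 ≤ opNorm A := norm_nonneg _

theorem vnorm_mulVec_le (A : Matrix ι ι ℂ) (u : ι → ℂ) :
    vnorm (A.mulVec u) ≤ opNorm A * vnorm u := by
  simpa [vnorm, opNorm, Matrix.toEuclideanCLM_toLp] using
    (Matrix.toEuclideanCLM (n := ι) (𝕜 := ℂ) A).le_opNorm (WithLp.toLp 2 u)

theorem opNorm_le {A : Matrix ι ι ℂ} {c : ℝ} (hc : 0 ≤ c)
    (h : ∀ u, vnorm (A.mulVec u) ≤ c * vnorm u) : opNorm A ≤ c :=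
  ContinuousLinearMap.opNorm_le_bound _ hc fun x => h x.ofLp

theorem opNorm_mul_le (A B : Matrix ι ι ℂ) : opNorm (A * B) ≤ opNorm A * opNorm B := by
  simpa [opNorm, map_mul] using norm_mul_le (Matrix.toEuclideanCLM (n := ι) (𝕜 := ℂ) A)
    (Matrix.toEuclideanCLM (n := ι) (𝕜 := ℂ) B)

theorem opNorm_smul (c : ℂ) (A : Matrix ι ι ℂ) : opNorm (c • A) = ‖c‖ * opNorm A := by
  simp [opNorm, norm_smul]

@[simp] theorem opNorm_neg (A : Matrix ι ι ℂ) : opNorm (-A) = opNorm A := by simp [opNorm]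

theorem opNorm_one [Nonempty ι] : opNorm (1 : Matrix ι ι ℂ) = 1 := by
  simp [opNorm]

theorem norm_entry_le_opNorm (A : Matrix ι ι ℂ) (i j : ι) : ‖A i j‖ ≤ opNorm A := by
  have h := vnorm_mulVec_le A (Pi.single j 1)
  have h1 : vnorm (Pi.single j 1 : ι → ℂ) = 1 := by
    simp [vnorm]
  rw [h1, mul_one] at h
  refine le_trans ?_ h
  have := norm_entry_le_vnorm (A.mulVec (Pi.single j 1)) i
  simpa using this

theorem inv_smul_matrix {k : ℂ} (hk : k ≠ 0) (A : Matrix ι ι ℂ) : (k • A)⁻¹ = k⁻¹ • A⁻¹ := by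
  by_cases hd : IsUnit A.det
  · apply Matrix.inv_eq_left_inv
    rw [smul_mul_smul_comm, inv_mul_cancel₀ hk, Matrix.nonsing_inv_mul _ hd, one_smul]
  · rw [Matrix.nonsing_inv_apply_not_isUnit _ hd, Matrix.nonsing_inv_apply_not_isUnit, smul_zero]
    rw [Matrix.det_smul]
    simp_all

/-- A lower bound of a matrix on vectors makes it invertible. -/
theorem det_ne_zero_of_vnorm {A : Matrix ι ι ℂ} (h : ∀ u, u ≠ 0 → A.mulVec u ≠ 0) :
    A.det ≠ 0 := by
  intro hA
  obtain ⟨v, hv, hv'⟩ := Matrix.exists_mulVec_eq_zero_iff.2 hA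
  exact h v hv hv'

theorem mulVec_inv_cancel {A : Matrix ι ι ℂ} (hA : A.det ≠ 0) (u : ι → ℂ) :
    A.mulVec (A⁻¹.mulVec u) = u := by
  rw [Matrix.mulVec_mulVec, Matrix.mul_nonsing_inv _ (isUnit_iff_ne_zero.2 hA), Matrix.one_mulVec]

theorem inv_mulVec_cancel {A : Matrix ι ι ℂ} (hA : A.det ≠ 0) (u : ι → ℂ) :
    A⁻¹.mulVec (A.mulVec u) = u := by
  rw [Matrix.mulVec_mulVec, Matrix.nonsing_inv_mul _ (isUnit_iff_ne_zero.2 hA), Matrix.one_mulVec]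

theorem opNorm_inv_le {A : Matrix ι ι ℂ} {c : ℝ} (hc : 0 ≤ c) (hA : A.det ≠ 0)
    (h : ∀ u, vnorm u ≤ c * vnorm (A.mulVec u)) : opNorm A⁻¹ ≤ c :=
  opNorm_le hc fun u => by
    have := h (A⁻¹.mulVec u)
    rwa [mulVec_inv_cancel hA] at this

end Norms

/-! ### Homogeneous coordinates -/

section Coordinates

variable {n : ℕ}

/-- The part `z'` of `z`. -/
def fstPart (v : Idx n → ℂ) : Fin (n + 1) → ℂ := fun i => v (Sum.inl i)

/-- The part `z''` of `z`. -/
def sndPart (v : Idx n → ℂ) : Fin (n + 1) → ℂ := fun i => v (Sum.inr i)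

@[simp] theorem fstPart_elim (x y : Fin (n + 1) → ℂ) : fstPart (Sum.elim x y) = x := rfl

@[simp] theorem sndPart_elim (x y : Fin (n + 1) → ℂ) : sndPart (Sum.elim x y) = y := rfl

@[simp] theorem elim_parts (v : Idx n → ℂ) : Sum.elim (fstPart v) (sndPart v) = v := by
  ext (i | i) <;> rfl

@[simp] theorem fstPart_smul (c : ℂ) (v : Idx n → ℂ) : fstPart (c • v) = c • fstPart v := rfl

@[simp] theorem sndPart_smul (c : ℂ) (v : Idx n → ℂ) : sndPart (c • v) = c • sndPart v := rfl

@[simp] theorem fstPart_zero : fstPart (0 : Idx n → ℂ) = 0 := rfl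

@[simp] theorem sndPart_zero : sndPart (0 : Idx n → ℂ) = 0 := rfl

theorem eq_zero_of_parts {v : Idx n → ℂ} (h₁ : fstPart v = 0) (h₂ : sndPart v = 0) : v = 0 := by
  rw [← elim_parts v, h₁, h₂]
  ext (i | i) <;> rfl

@[fun_prop]
theorem continuous_fstPart : Continuous (fstPart : (Idx n → ℂ) → _) := by
  unfold fstPart; fun_prop

@[fun_prop]
theorem continuous_sndPart : Continuous (sndPart : (Idx n → ℂ) → _) := by
  unfold sndPart; fun_prop

theorem fstPart_mulVec (M : Matrix (Idx n) (Idx n) ℂ) (v : Idx n → ℂ) :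
    fstPart (M.mulVec v) = M.toBlocks₁₁.mulVec (fstPart v) + M.toBlocks₁₂.mulVec (sndPart v) := by
  ext i
  simp [fstPart, sndPart, Matrix.mulVec, dotProduct, Matrix.toBlocks₁₁, Matrix.toBlocks₁₂]

theorem sndPart_mulVec (M : Matrix (Idx n) (Idx n) ℂ) (v : Idx n → ℂ) :
    sndPart (M.mulVec v) = M.toBlocks₂₁.mulVec (fstPart v) + M.toBlocks₂₂.mulVec (sndPart v) := by
  ext i
  simp [fstPart, sndPart, Matrix.mulVec, dotProduct, Matrix.toBlocks₂₁, Matrix.toBlocks₂₂]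

theorem smul_toBlocks₂₁ (c : ℂ) (M : Matrix (Idx n) (Idx n) ℂ) :
    (c • M).toBlocks₂₁ = c • M.toBlocks₂₁ := rfl

theorem mul_toBlocks₁₁ (M N : Matrix (Idx n) (Idx n) ℂ) :
    (M * N).toBlocks₁₁ = M.toBlocks₁₁ * N.toBlocks₁₁ + M.toBlocks₁₂ * N.toBlocks₂₁ := by
  conv_lhs => rw [← M.fromBlocks_toBlocks, ← N.fromBlocks_toBlocks, Matrix.fromBlocks_multiply]
  rfl

theorem mul_toBlocks₂₁ (M N : Matrix (Idx n) (Idx n) ℂ) :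
    (M * N).toBlocks₂₁ = M.toBlocks₂₁ * N.toBlocks₁₁ + M.toBlocks₂₂ * N.toBlocks₂₁ := by
  conv_lhs => rw [← M.fromBlocks_toBlocks, ← N.fromBlocks_toBlocks, Matrix.fromBlocks_multiply]
  rfl

end Coordinates

/-! ### Representatives of determinant one -/

section Representatives

variable {n : ℕ}

/-- `M` is a representative of determinant one of `g`. -/
def IsRep (M : Matrix (Idx n) (Idx n) ℂ) (g : PGLGroup n) : Prop :=
  M.det = 1 ∧ ∃ u : Matrix.GeneralLinearGroup (Idx n) ℂ,
    (u : Matrix (Idx n) (Idx n) ℂ) = M ∧ Matrix.ProjGenLinGroup.mk u = g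

theorem isRep_slRep (g : PGLGroup n) : IsRep (slRep g) g :=
  ⟨(exists_slRep g).choose.2, Matrix.SpecialLinearGroup.toGL (exists_slRep g).choose, rfl,
    (exists_slRep g).choose_spec⟩

namespace IsRep

variable {M N : Matrix (Idx n) (Idx n) ℂ} {g h : PGLGroup n}

theorem isUnit_det (hM : IsRep M g) : IsUnit M.det := by rw [hM.1]; exact isUnit_one

theorem mul (hM : IsRep M g) (hN : IsRep N h) : IsRep (M * N) (g * h) := by
  obtain ⟨h1, u, rfl, rfl⟩ := hM
  obtain ⟨h2, w, rfl, rfl⟩ := hN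
  exact ⟨by rw [Matrix.det_mul, h1, h2, one_mul], u * w, by simp, by simp⟩

theorem inv (hM : IsRep M g) : IsRep M⁻¹ g⁻¹ := by
  obtain ⟨h1, u, rfl, rfl⟩ := hM
  refine ⟨by rw [Matrix.det_nonsing_inv, h1]; simp, u⁻¹, by simp, by simp⟩

theorem conj_mk (hM : IsRep M g) (u : Matrix.GeneralLinearGroup (Idx n) ℂ) :
    IsRep ((u : Matrix (Idx n) (Idx n) ℂ) * M * (u : Matrix (Idx n) (Idx n) ℂ)⁻¹)
      (Matrix.ProjGenLinGroup.mk u * g * (Matrix.ProjGenLinGroup.mk u)⁻¹) := by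
  obtain ⟨h1, w, rfl, rfl⟩ := hM
  refine ⟨?_, u * w * u⁻¹, by simp, by simp⟩
  rw [Matrix.det_mul, Matrix.det_mul, h1, mul_one, ← Matrix.det_mul,
    Matrix.mul_nonsing_inv _ ((Matrix.isUnit_iff_isUnit_det _).1 u.isUnit), Matrix.det_one]

/-- Comparing determinants gives `ζ ^ (2n+2) = 1`. This makes every norm condition below independent
of the representative that `slRep` chooses. -/
theorem exists_unit_smul (hM : IsRep M g) (hN : IsRep N g) : ∃ ζ : ℂ, ‖ζ‖ = 1 ∧ N = ζ • M := by
  obtain ⟨h1, u, rfl, rfl⟩ := hM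
  obtain ⟨h2, w, rfl, hw⟩ := hN
  obtain ⟨c, hc⟩ := Matrix.ProjGenLinGroup.mk_eq_mk_iff.1 hw.symm
  have hcm : (w : Matrix (Idx n) (Idx n) ℂ) = (c : ℂ) • (u : Matrix (Idx n) (Idx n) ℂ) := by
    rw [← hc]
    simp [← Matrix.smul_one_eq_diagonal]
  refine ⟨c, ?_, hcm⟩
  rw [hcm, Matrix.det_smul, h1, mul_one] at h2
  have := congrArg norm h2
  rw [norm_pow, norm_one] at this
  exact (pow_eq_one_iff_of_nonneg (norm_nonneg _) Fintype.card_ne_zero).1 this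

theorem radius_eq (hM : IsRep M g) : radius g = opNorm (M.toBlocks₂₁)⁻¹ := by
  obtain ⟨ζ, hζ, h⟩ := hM.exists_unit_smul (isRep_slRep g)
  have hζ0 : ζ ≠ 0 := by rintro rfl; simp at hζ
  unfold radius blockC
  rw [h, smul_toBlocks₂₁]
  rw [inv_smul_matrix hζ0, opNorm_smul, norm_inv, hζ, inv_one, one_mul]

theorem det_blockC_ne_zero_iff (hM : IsRep M g) :
    (blockC g).det ≠ 0 ↔ M.toBlocks₂₁.det ≠ 0 := by
  obtain ⟨ζ, hζ, h⟩ := hM.exists_unit_smul (isRep_slRep g)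
  have hζ0 : ζ ≠ 0 := by rintro rfl; simp at hζ
  unfold blockC
  rw [h, smul_toBlocks₂₁, Matrix.det_smul]
  simp [hζ0]

theorem mulVec_ne_zero (hM : IsRep M g) {v : Idx n → ℂ} (hv : v ≠ 0) : M.mulVec v ≠ 0 := by
  intro h
  exact hv (by rw [← inv_mulVec_cancel (A := M) (by rw [hM.1]; exact one_ne_zero) v, h,
    Matrix.mulVec_zero])

theorem smul_mk (hM : IsRep M g) {v : Idx n → ℂ} (hv : v ≠ 0) :
    g • (Projectivization.mk ℂ v hv : PSpace n) =
      Projectivization.mk ℂ (M.mulVec v) (hM.mulVec_ne_zero hv) := by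
  obtain ⟨h1, u, rfl, rfl⟩ := hM
  exact Projectivization.PGL.mk_smul_mk u hv

theorem mem_deltaBar_mk_iff (hM : IsRep M g) {v : Idx n → ℂ} (hv : v ≠ 0) :
    (Projectivization.mk ℂ v hv : PSpace n) ∈ deltaBar g ↔
      vnorm (sndPart v) ≤ vnorm (sndPart (M.mulVec v)) := by
  obtain ⟨ζ, hζ, h⟩ := hM.exists_unit_smul (isRep_slRep g)
  obtain ⟨a, ha⟩ := Projectivization.exists_smul_eq_mk_rep ℂ v hv
  have h2 : vnorm (sndPart ((slRep g).mulVec (Projectivization.mk ℂ v hv).rep)) =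
      ‖(a : ℂ)‖ * vnorm (sndPart (M.mulVec v)) := by
    rw [← ha, h, Units.smul_def, Matrix.smul_mulVec, Matrix.mulVec_smul, sndPart_smul, sndPart_smul,
      vnorm_smul, vnorm_smul, hζ, one_mul]
  have h1 : sndNorm (Projectivization.mk ℂ v hv) = ‖(a : ℂ)‖ * vnorm (sndPart v) := by
    rw [← vnorm_smul, ← sndPart_smul, ← Units.smul_def, ha]; rfl
  rw [sndPart_mulVec] at h2
  change sndNorm (Projectivization.mk ℂ v hv) ≤ vnorm _ ↔ _
  rw [h1]
  erw [h2]
  exact mul_le_mul_iff_right₀ (norm_pos_iff.2 a.ne_zero)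

end IsRep

theorem fst_snd_mk {v : Idx n → ℂ} (hv : v ≠ 0) : ∃ c : ℝ, 0 < c ∧
    fstNorm (Projectivization.mk ℂ v hv) = c * vnorm (fstPart v) ∧
    sndNorm (Projectivization.mk ℂ v hv) = c * vnorm (sndPart v) := by
  obtain ⟨a, ha⟩ := Projectivization.exists_smul_eq_mk_rep ℂ v hv
  refine ⟨‖(a : ℂ)‖, norm_pos_iff.2 a.ne_zero, ?_, ?_⟩
  · rw [← vnorm_smul, ← fstPart_smul, ← Units.smul_def, ha]; rfl
  · rw [← vnorm_smul, ← sndPart_smul, ← Units.smul_def, ha]; rfl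

theorem mk_mem_tube_iff {R : ℝ} {v : Idx n → ℂ} (hv : v ≠ 0) :
    (Projectivization.mk ℂ v hv : PSpace n) ∈ tube R ↔
      R * vnorm (sndPart v) < vnorm (fstPart v) := by
  obtain ⟨c, hc, h1, h2⟩ := fst_snd_mk hv
  change R * sndNorm _ < fstNorm _ ↔ _
  rw [h1, h2, mul_left_comm]
  exact mul_lt_mul_iff_right₀ hc

theorem mk_mem_closedTube_iff {r : ℝ} {v : Idx n → ℂ} (hv : v ≠ 0) :
    r * sndNorm (Projectivization.mk ℂ v hv) ≤ fstNorm (Projectivization.mk ℂ v hv) ↔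
      r * vnorm (sndPart v) ≤ vnorm (fstPart v) := by
  obtain ⟨c, hc, h1, h2⟩ := fst_snd_mk hv
  rw [h1, h2, mul_left_comm]
  exact mul_le_mul_iff_right₀ hc

theorem isOpen_iff_preimage_mk' {U : Set (PSpace n)} : IsOpen U ↔
    IsOpen ((Projectivization.mk' ℂ : {v : Idx n → ℂ // v ≠ 0} → PSpace n) ⁻¹' U) :=
  isOpen_coinduced

theorem continuous_mk' :
    Continuous (Projectivization.mk' ℂ : {v : Idx n → ℂ // v ≠ 0} → PSpace n) :=
  continuous_coinduced_rng

theorem isOpen_tube (R : ℝ) : IsOpen (tube R : Set (PSpace n)) := by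
  rw [isOpen_iff_preimage_mk']
  have : (Projectivization.mk' ℂ : {v : Idx n → ℂ // v ≠ 0} → PSpace n) ⁻¹' tube R =
      {v | R * vnorm (sndPart v.1) < vnorm (fstPart v.1)} := by
    ext v
    exact mk_mem_tube_iff v.2
  rw [this]
  exact isOpen_lt (by fun_prop) (by fun_prop)

/-- The vectors that represent points near the point represented by `v`. -/
theorem eventually_mk_mem {U : Set (PSpace n)} (hU : IsOpen U) {v : Idx n → ℂ} (hv : v ≠ 0)
    (h : Projectivization.mk ℂ v hv ∈ U) :
    ∀ᶠ u in 𝓝 v, ∃ hu : u ≠ 0, Projectivization.mk ℂ u hu ∈ U := by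
  have h1 : IsOpen ((Projectivization.mk' ℂ : {v : Idx n → ℂ // v ≠ 0} → PSpace n) ⁻¹' U) :=
    isOpen_iff_preimage_mk'.1 hU
  have h2 : IsOpen (Subtype.val ''
      ((Projectivization.mk' ℂ : {v : Idx n → ℂ // v ≠ 0} → PSpace n) ⁻¹' U)) :=
    (isOpen_compl_singleton (x := (0 : Idx n → ℂ))).isOpenMap_subtype_val _ h1
  filter_upwards [h2.mem_nhds ⟨⟨v, hv⟩, h, rfl⟩]
  rintro _ ⟨⟨u, hu⟩, hu', rfl⟩
  exact ⟨hu, hu'⟩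

end Representatives

/-! ### Elements that move a tube off itself -/

section Tubes

variable {n : ℕ} {R : ℝ} {M : Matrix (Idx n) (Idx n) ℂ} {g : PGLGroup n}

/-- `M` maps the vectors over `V_R` to vectors outside of `V_R`. -/
def MovesTube (R : ℝ) (M : Matrix (Idx n) (Idx n) ℂ) : Prop :=
  ∀ v, R * vnorm (sndPart v) < vnorm (fstPart v) →
    vnorm (fstPart (M.mulVec v)) ≤ R * vnorm (sndPart (M.mulVec v))

theorem IsRep.disjoint_tube_iff (hM : IsRep M g) :
    Disjoint ((fun p : PSpace n => g • p) '' tube R) (tube R) ↔ MovesTube R M := by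
  constructor
  · intro h v hv
    have hv0 : v ≠ 0 := by
      rintro rfl
      simp at hv
    by_contra! hlt
    refine Set.disjoint_left.1 h ⟨_, (mk_mem_tube_iff hv0).2 hv, rfl⟩ ?_
    change g • Projectivization.mk ℂ v hv0 ∈ _
    rw [hM.smul_mk hv0]
    exact (mk_mem_tube_iff _).2 hlt
  · intro h
    rw [Set.disjoint_left]
    rintro _ ⟨p, hp, rfl⟩
    induction p using Projectivization.ind with | h v hv =>
    intro hmem
    change g • Projectivization.mk ℂ v hv ∈ _ at hmem
    rw [hM.smul_mk hv, mk_mem_tube_iff] at hmem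
    exact (h v ((mk_mem_tube_iff hv).1 hp)).not_gt hmem

theorem MovesTube.sndPart_ne_zero (h : MovesTube R M) (hM : IsRep M g) {v : Idx n → ℂ}
    (hv : R * vnorm (sndPart v) < vnorm (fstPart v)) : sndPart (M.mulVec v) ≠ 0 := by
  intro h0
  have h1 := h v hv
  rw [h0, vnorm_zero, mul_zero] at h1
  have h2 := vnorm_eq_zero.1 (le_antisymm h1 (vnorm_nonneg _))
  refine hM.mulVec_ne_zero ?_ (eq_zero_of_parts h2 h0)
  rintro rfl
  simp at hv

theorem MovesTube.det_ne_zero (h : MovesTube R M) (hM : IsRep M g) :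
    M.toBlocks₂₁.det ≠ 0 := by
  refine det_ne_zero_of_vnorm fun u hu => ?_
  have := h.sndPart_ne_zero hM (v := Sum.elim u 0) (by simpa using vnorm_pos hu)
  simpa [sndPart_mulVec] using this

/-- The vectors `(-C⁻¹D y, y)` form the preimage of the plane `z'' = 0`, which lies in the tube, so
they must lie outside the tube. -/
theorem MovesTube.vnorm_inv_mul_le (h : MovesTube R M) (hM : IsRep M g) (y : Fin (n + 1) → ℂ) :
    vnorm ((M.toBlocks₂₁⁻¹ * M.toBlocks₂₂).mulVec y) ≤ R * vnorm y := by
  by_contra! hlt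
  refine h.sndPart_ne_zero hM (v := Sum.elim (-(M.toBlocks₂₁⁻¹ * M.toBlocks₂₂).mulVec y) y)
    (by simpa using hlt) ?_
  rw [sndPart_mulVec, fstPart_elim, sndPart_elim, Matrix.mulVec_neg, ← Matrix.mulVec_mulVec,
    mulVec_inv_cancel (h.det_ne_zero hM), neg_add_cancel]

/-- The graph of `AC⁻¹` is the image of the plane `z'' = 0`. -/
theorem MovesTube.vnorm_mul_inv_le (h : MovesTube R M) (hM : IsRep M g) (y : Fin (n + 1) → ℂ) :
    vnorm ((M.toBlocks₁₁ * M.toBlocks₂₁⁻¹).mulVec y) ≤ R * vnorm y := by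
  have hC := h.det_ne_zero hM
  by_cases hy : y = 0
  · simp [hy]
  have hy' : M.toBlocks₂₁⁻¹.mulVec y ≠ 0 := by
    intro h0
    apply hy
    rw [← mulVec_inv_cancel hC y, h0, Matrix.mulVec_zero]
  have := h (Sum.elim (M.toBlocks₂₁⁻¹.mulVec y) 0) (by simpa using vnorm_pos hy')
  simpa [fstPart_mulVec, sndPart_mulVec, mulVec_inv_cancel hC, ← Matrix.mulVec_mulVec] using this

/-- The lower bound for `‖C z' + D z''‖`. -/
theorem vnorm_fst_sub_le (hC : M.toBlocks₂₁.det ≠ 0)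
    (h : ∀ y, vnorm ((M.toBlocks₂₁⁻¹ * M.toBlocks₂₂).mulVec y) ≤ R * vnorm y) (v : Idx n → ℂ) :
    vnorm (fstPart v) - R * vnorm (sndPart v) ≤
      opNorm M.toBlocks₂₁⁻¹ * vnorm (sndPart (M.mulVec v)) := by
  have h1 := vnorm_mulVec_le M.toBlocks₂₁⁻¹ (sndPart (M.mulVec v))
  rw [sndPart_mulVec, Matrix.mulVec_add, inv_mulVec_cancel hC, Matrix.mulVec_mulVec] at h1
  rw [sndPart_mulVec]
  have h2 := vnorm_sub_vnorm_le (fstPart v) ((M.toBlocks₂₁⁻¹ * M.toBlocks₂₂).mulVec (sndPart v))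
  linarith [h (sndPart v)]

theorem tube_anti {R R' : ℝ} (h : R ≤ R') : tube R' ⊆ (tube R : Set (PSpace n)) := by
  intro p hp
  change R * sndNorm p < fstNorm p
  refine lt_of_le_of_lt ?_ hp
  exact mul_le_mul_of_nonneg_right h (vnorm_nonneg _)

theorem AdmissibleCoordinates.exists_movesTube {Γ : Subgroup (PGLGroup n)}
    (h : AdmissibleCoordinates Γ) :
    ∃ R : ℝ, 0 < R ∧ ∀ g ∈ Γ, g ≠ 1 → ∀ M, IsRep M g → MovesTube R M := by
  obtain ⟨R, hR, -, h⟩ := h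
  exact ⟨R, hR, fun g hg hg1 M hM => hM.disjoint_tube_iff.1 (h g hg hg1)⟩

/-- The `F`-region contains a neighbourhood of the plane `z'' = 0`. -/
theorem exists_tube_subset_fRegion {Γ : Subgroup (PGLGroup n)} (hadm : AdmissibleCoordinates Γ)
    (hclub : Club Γ) : ∃ ρ : ℝ, 0 < ρ ∧ tube ρ ⊆ fRegion Γ := by
  obtain ⟨R, hR, h⟩ := hadm.exists_movesTube
  obtain ⟨b, hb⟩ := hclub
  -- On this tube `‖z'‖ - R‖z''‖` exceeds `max b 1 * ‖z''‖`, while it is at most `‖C⁻¹‖ ‖Cz' +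
  -- Dz''‖`. The maximum with `1` only provides a positive factor to cancel.
  refine ⟨R + max b 1, by positivity, interior_maximal ?_ (isOpen_tube _)⟩
  intro p hp
  rw [Set.mem_iInter₂]
  rintro g ⟨hg, hg1⟩
  have hM := isRep_slRep g
  have hm := h g hg hg1 _ hM
  induction p using Projectivization.ind with | h v hv =>
  rw [mk_mem_tube_iff] at hp
  rw [hM.mem_deltaBar_mk_iff]
  have h1 := vnorm_fst_sub_le (hm.det_ne_zero hM) (hm.vnorm_inv_mul_le hM) v
  rw [← hM.radius_eq] at h1
  have h2 : radius g ≤ max b 1 := (hb g hg hg1).trans (le_max_left _ _)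
  have h3 := mul_le_mul_of_nonneg_right h2 (vnorm_nonneg (sndPart ((slRep g).mulVec v)))
  have h4 : (0 : ℝ) < max b 1 := by positivity
  refine le_of_mul_le_mul_left ?_ h4
  linarith

end Tubes

/-! ### The conjugations in terms of representatives -/

section Conjugations

variable {n : ℕ} {M : Matrix (Idx n) (Idx n) ℂ} {g : PGLGroup n}

theorem mem_conj {x g : PGLGroup n} {Γ : Subgroup (PGLGroup n)} :
    g ∈ conj x Γ ↔ ∃ h ∈ Γ, x * h * x⁻¹ = g := Iff.rfl

theorem IsRep.conj_ofInverse (hM : IsRep M g) {P Q : Matrix (Idx n) (Idx n) ℂ} (h₁ : P * Q = 1)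
    (h₂ : Q * P = 1) :
    IsRep (P * M * Q) (ofInverse P Q h₁ h₂ * g * (ofInverse P Q h₁ h₂)⁻¹) := by
  have := hM.conj_mk ⟨P, Q, h₁, h₂⟩
  rwa [Matrix.inv_eq_right_inv h₁] at this

theorem IsRep.conj_alpha {a : ℝ} (hM : IsRep M g) (ha : 0 < a) :
    IsRep (Matrix.fromBlocks M.toBlocks₁₁ ((a : ℂ) ^ 2 • M.toBlocks₁₂)
      (((a : ℂ)⁻¹) ^ 2 • M.toBlocks₂₁) M.toBlocks₂₂) (alpha n a ha * g * (alpha n a ha)⁻¹) := by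
  have h : (a : ℂ) ≠ 0 := Complex.ofReal_ne_zero.mpr ha.ne'
  have : IsRep (Matrix.fromBlocks ((a : ℂ) • (1 : Blk n)) 0 0 ((a : ℂ)⁻¹ • (1 : Blk n)) * M *
      Matrix.fromBlocks ((a : ℂ)⁻¹ • (1 : Blk n)) 0 0 ((a : ℂ) • (1 : Blk n)))
      (alpha n a ha * g * (alpha n a ha)⁻¹) := hM.conj_ofInverse _ _
  convert this using 1
  conv_rhs => rw [← M.fromBlocks_toBlocks]
  simp [Matrix.fromBlocks_multiply, smul_smul, h, sq, -Complex.coe_smul]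

theorem IsRep.conj_sigma (hM : IsRep M g) :
    IsRep (Matrix.fromBlocks M.toBlocks₂₂ M.toBlocks₂₁ M.toBlocks₁₂ M.toBlocks₁₁)
      (sigma n * g * (sigma n)⁻¹) := by
  have : IsRep (Matrix.fromBlocks (0 : Blk n) 1 1 0 * M * Matrix.fromBlocks (0 : Blk n) 1 1 0)
      (sigma n * g * (sigma n)⁻¹) := hM.conj_ofInverse _ _
  convert this using 1
  conv_rhs => rw [← M.fromBlocks_toBlocks]
  simp [Matrix.fromBlocks_multiply]

/-- The matrix `τ M τ⁻¹`. -/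
def tauConj (M : Matrix (Idx n) (Idx n) ℂ) : Matrix (Idx n) (Idx n) ℂ :=
  Matrix.fromBlocks (1 : Blk n) 1 (-1) 1 * M * ((2 : ℂ)⁻¹ • Matrix.fromBlocks (1 : Blk n) (-1) 1 1)

theorem IsRep.conj_tau (hM : IsRep M g) : IsRep (tauConj M) (tau n * g * (tau n)⁻¹) :=
  hM.conj_ofInverse _ _

theorem tauConj_toBlocks₁₁ (M : Matrix (Idx n) (Idx n) ℂ) : (tauConj M).toBlocks₁₁ =
    (2 : ℂ)⁻¹ • ((M.toBlocks₁₁ + M.toBlocks₁₂) + (M.toBlocks₂₁ + M.toBlocks₂₂)) := by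
  unfold tauConj
  conv_lhs => rw [← M.fromBlocks_toBlocks]
  simp [Matrix.fromBlocks_multiply, Matrix.fromBlocks_smul]
  module

theorem tauConj_toBlocks₂₁ (M : Matrix (Idx n) (Idx n) ℂ) : (tauConj M).toBlocks₂₁ =
    (2 : ℂ)⁻¹ • ((M.toBlocks₂₁ + M.toBlocks₂₂) - (M.toBlocks₁₁ + M.toBlocks₁₂)) := by
  unfold tauConj
  conv_lhs => rw [← M.fromBlocks_toBlocks]
  simp [Matrix.fromBlocks_multiply, Matrix.fromBlocks_smul]
  module

theorem alpha_smul_mk {a : ℝ} (ha : 0 < a) {v : Idx n → ℂ} (hv : v ≠ 0) :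
    ∃ hv' : Sum.elim ((a : ℂ)⁻¹ • fstPart v) ((a : ℂ) • sndPart v) ≠ 0,
      alpha n a ha • (Projectivization.mk ℂ (Sum.elim ((a : ℂ)⁻¹ • fstPart v)
        ((a : ℂ) • sndPart v)) hv' : PSpace n) = Projectivization.mk ℂ v hv := by
  have h : (a : ℂ) ≠ 0 := Complex.ofReal_ne_zero.mpr ha.ne'
  have hv' : Sum.elim ((a : ℂ)⁻¹ • fstPart v) ((a : ℂ) • sndPart v) ≠ 0 := by
    intro h0
    refine hv (eq_zero_of_parts ?_ ?_)
    · simpa [h, -Complex.coe_smul] using congrArg fstPart h0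
    · simpa [h, -Complex.coe_smul] using congrArg sndPart h0
  refine ⟨hv', ?_⟩
  rw [alpha, ofInverse, Projectivization.PGL.mk_smul_mk, Projectivization.mk_eq_mk_iff']
  refine ⟨1, ?_⟩
  rw [one_smul]
  conv_lhs => rw [← elim_parts v]
  ext (i | i) <;> simp [Matrix.fromBlocks_mulVec, Matrix.smul_mulVec, h, Function.comp_def]

theorem radius_conj_alpha {a : ℝ} (ha : 0 < a) :
    radius (alpha n a ha * g * (alpha n a ha)⁻¹) = a ^ 2 * radius g := by
  have h : (a : ℂ) ≠ 0 := Complex.ofReal_ne_zero.mpr ha.ne'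
  have hM := isRep_slRep g
  rw [(hM.conj_alpha ha).radius_eq, hM.radius_eq, Matrix.toBlocks_fromBlocks₂₁,
    inv_smul_matrix (pow_ne_zero _ (inv_ne_zero h)), opNorm_smul]
  simp

theorem conj_eq_one_iff {x h : PGLGroup n} : x * h * x⁻¹ = 1 ↔ h = 1 := by
  simp

/-- Suitable parameters exist. -/
theorem exists_suitable {Γ₁ Γ₂ : Subgroup (PGLGroup n)}
    (hadm₁ : AdmissibleCoordinates Γ₁) (hadm₂ : AdmissibleCoordinates Γ₂)
    (hclub₁ : Club Γ₁) (hclub₂ : Club Γ₂) {r : ℝ} (hr : 0 < r) :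
    ∃ (a : ℝ) (ha : 0 < a), Suitable Γ₁ Γ₂ r a ha := by
  obtain ⟨ρ₁, hρ₁, h₁⟩ := exists_tube_subset_fRegion hadm₁ hclub₁
  obtain ⟨ρ₂, hρ₂, h₂⟩ := exists_tube_subset_fRegion hadm₂ hclub₂
  obtain ⟨b₁, hb₁⟩ := id hclub₁
  obtain ⟨b₂, hb₂⟩ := id hclub₂
  set ρ := max ρ₁ ρ₂
  have hρ : 0 < ρ := lt_max_of_lt_left hρ₁
  set b := max 1 (max b₁ b₂)
  have hb : 0 < b := by positivity
  -- Conjugation by `α` multiplies each `‖C⁻¹‖` by `a²`, and `α` multiplies the ratio `‖z'‖/‖z''‖`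
  -- by `a²`. The bound `a ≤ 1` reduces `a²` to `a`, and the factor `2` turns the closed condition
  -- at `r` into the strict one of the tube.
  set a := min 1 (min (r / (2 * ρ)) (1 / b)) with ha_def
  have ha : 0 < a := by positivity
  have ha1 : a ≤ 1 := min_le_left _ _
  have ha2 : a * (2 * ρ) ≤ r := by
    rw [← le_div_iff₀ (by positivity)]
    exact (min_le_right _ _).trans (min_le_left _ _)
  have ha3 : a * b ≤ 1 := by
    rw [← le_div_iff₀ hb]
    exact (min_le_right _ _).trans (min_le_right _ _)
  have haa : a ^ 2 ≤ a := by nlinarith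
  have key : ∀ Γ : Subgroup (PGLGroup n),
      (∀ g ∈ Γ, g ≠ 1 → radius g ≤ b) → ∀ g ∈ conj (alpha n a ha) Γ, g ≠ 1 → radius g ≤ 1 := by
    rintro Γ hΓ _ ⟨h, hh, rfl⟩ hg1
    change alpha n a ha * h * (alpha n a ha)⁻¹ ≠ 1 at hg1
    change radius (alpha n a ha * h * (alpha n a ha)⁻¹) ≤ 1
    rw [Ne, conj_eq_one_iff] at hg1
    rw [radius_conj_alpha ha]
    calc a ^ 2 * radius h ≤ a * b :=
          mul_le_mul haa (hΓ h hh hg1) (opNorm_nonneg _) ha.le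
      _ ≤ 1 := ha3
  refine ⟨a, ha, ?_, key Γ₁ fun g hg hg1 => (hb₁ g hg hg1).trans ?_,
    key Γ₂ fun g hg hg1 => (hb₂ g hg hg1).trans ?_⟩
  · intro p hp
    induction p using Projectivization.ind with | h v hv =>
    change r * sndNorm _ ≤ fstNorm _ at hp
    rw [mk_mem_closedTube_iff] at hp
    obtain ⟨hv', h⟩ := alpha_smul_mk ha hv
    refine ⟨_, ?_, h⟩
    have hmem : (Projectivization.mk ℂ _ hv' : PSpace n) ∈ tube ρ := by
      rw [mk_mem_tube_iff, fstPart_elim, sndPart_elim, vnorm_smul, vnorm_smul, norm_inv,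
        Complex.norm_real, Real.norm_of_nonneg ha.le, ← mul_lt_mul_iff_right₀ ha,
        mul_inv_cancel_left₀ ha.ne']
      by_cases hs : sndPart v = 0
      · have : fstPart v ≠ 0 := fun h0 => hv (eq_zero_of_parts h0 hs)
        rw [hs]
        simpa using vnorm_pos this
      · have := vnorm_pos hs
        refine lt_of_lt_of_le ?_ hp
        have h5 : a * (ρ * a) < r := by nlinarith
        calc a * (ρ * (a * vnorm (sndPart v))) = (a * (ρ * a)) * vnorm (sndPart v) := by ring
          _ < _ := mul_lt_mul_of_pos_right h5 this
    exact ⟨h₁ (tube_anti (le_max_left _ _) hmem), h₂ (tube_anti (le_max_right _ _) hmem)⟩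
  · exact (le_max_left _ _).trans (le_max_right _ _)
  · exact (le_max_right _ _).trans (le_max_right _ _)

end Conjugations

/-! ### The constant of the combination -/

section CombConst

variable {n : ℕ} {r : ℝ}

theorem det_one_sub_ne_zero {X : Blk n} (hX : opNorm X ≤ r) (hr : r < 1) : (1 - X).det ≠ 0 := by
  refine det_ne_zero_of_vnorm fun u hu h => ?_
  rw [Matrix.sub_mulVec, Matrix.one_mulVec, sub_eq_zero] at h
  have h1 := vnorm_mulVec_le X u
  rw [← h] at h1
  have := vnorm_pos hu
  nlinarith [mul_le_mul_of_nonneg_right hX this.le]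

/-- The Hermitian product. -/
def hprod (u v : Fin (n + 1) → ℂ) : ℂ :=
  inner ℂ (WithLp.toLp 2 u : EuclideanSpace ℂ (Fin (n + 1))) (WithLp.toLp 2 v)

theorem re_hprod_le (u v : Fin (n + 1) → ℂ) : (hprod u v).re ≤ vnorm u * vnorm v :=
  (Complex.re_le_norm _).trans (norm_inner_le_norm _ _)

theorem hprod_add_right (u v w : Fin (n + 1) → ℂ) :
    hprod u (v + w) = hprod u v + hprod u w := by
  simp [hprod]

theorem re_hprod_sub_add (u v : Fin (n + 1) → ℂ) :
    (hprod (u - v) (u + v)).re = vnorm u ^ 2 - vnorm v ^ 2 := by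
  unfold hprod vnorm
  rw [WithLp.toLp_sub, WithLp.toLp_add]
  generalize (WithLp.toLp 2 u : EuclideanSpace ℂ (Fin (n + 1))) = x
  generalize (WithLp.toLp 2 v : EuclideanSpace ℂ (Fin (n + 1))) = y
  have h1 : (inner ℂ x y).re = (inner ℂ y x).re := inner_re_symm (𝕜 := ℂ) x y
  have h2 : (inner ℂ x x).re = ‖x‖ ^ 2 := by
    rw [inner_self_eq_norm_sq_to_K]; norm_cast
  have h3 : (inner ℂ y y).re = ‖y‖ ^ 2 := by
    rw [inner_self_eq_norm_sq_to_K]; norm_cast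
  rw [inner_sub_left, inner_add_right, inner_add_right]
  simp only [Complex.sub_re, Complex.add_re]
  linarith

/-- The Cayley transform of a contraction has positive real part. -/
theorem le_re_hprod_cayley {X : Blk n} (hX : opNorm X ≤ r) (hr0 : 0 ≤ r) (hr : r < 1)
    (v : Fin (n + 1) → ℂ) :
    (1 - r) / (1 + r) * vnorm v ^ 2 ≤ (hprod v (((1 + X) * (1 - X)⁻¹).mulVec v)).re := by
  have hd := det_one_sub_ne_zero hX hr
  -- With `v = (1 - X)u` the real part is `‖u‖² - ‖Xu‖² ≥ (1 - r²)‖u‖²`, while `‖v‖² ≤ (1 +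
  -- r)²‖u‖²`; the quotient is `(1 - r)/(1 + r)`.
  obtain ⟨u, rfl⟩ : ∃ u, (1 - X).mulVec u = v := ⟨_, mulVec_inv_cancel hd v⟩
  rw [← Matrix.mulVec_mulVec, inv_mulVec_cancel hd, Matrix.sub_mulVec, Matrix.add_mulVec,
    Matrix.one_mulVec, re_hprod_sub_add]
  have h1 : vnorm (X.mulVec u) ≤ r * vnorm u :=
    (vnorm_mulVec_le X u).trans (mul_le_mul_of_nonneg_right hX (vnorm_nonneg _))
  have h2 : vnorm (u - X.mulVec u) ≤ (1 + r) * vnorm u := by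
    linarith [vnorm_sub_le u (X.mulVec u)]
  have h3 := pow_le_pow_left₀ (vnorm_nonneg _) h1 2
  have h4 := pow_le_pow_left₀ (vnorm_nonneg _) h2 2
  have h5 : 0 < 1 + r := by linarith
  rw [div_mul_eq_mul_div, div_le_iff₀ h5]
  nlinarith [mul_le_mul_of_nonneg_left h4 (sub_nonneg.2 hr.le),
    mul_le_mul_of_nonneg_left h3 h5.le]

/-- Real parts add, so that of the sum is at least `2(1 - r)/(1 + r)`, and Cauchy–Schwarz turns this
into a lower bound for the norm. -/
theorem vnorm_cayley_add_ge {X Y : Blk n} (hX : opNorm X ≤ r) (hY : opNorm Y ≤ r) (hr0 : 0 ≤ r)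
    (hr : r < 1) (v : Fin (n + 1) → ℂ) : vnorm v ≤ (1 + r) / (2 * (1 - r)) *
      vnorm (((1 + X) * (1 - X)⁻¹ + (1 + Y) * (1 - Y)⁻¹).mulVec v) := by
  by_cases hv : v = 0
  · simp [hv]
  have h0 := vnorm_pos hv
  have h1 := le_re_hprod_cayley hX hr0 hr v
  have h2 := le_re_hprod_cayley hY hr0 hr v
  have h3 := re_hprod_le v (((1 + X) * (1 - X)⁻¹ + (1 + Y) * (1 - Y)⁻¹).mulVec v)
  rw [Matrix.add_mulVec, hprod_add_right, Complex.add_re, ← Matrix.add_mulVec] at h3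
  have h4 : 2 * ((1 - r) / (1 + r)) * vnorm v ≤
      vnorm (((1 + X) * (1 - X)⁻¹ + (1 + Y) * (1 - Y)⁻¹).mulVec v) := by
    refine le_of_mul_le_mul_left ?_ h0
    linarith
  have h5 : 0 < 1 + r := by linarith
  have h6 : 0 < 1 - r := by linarith
  rw [div_mul_eq_mul_div, le_div_iff₀ (by positivity)]
  rw [mul_div_assoc', div_mul_eq_mul_div, div_le_iff₀ h5] at h4
  linarith

theorem det_cayley_add_ne_zero {X Y : Blk n} (hX : opNorm X ≤ r) (hY : opNorm Y ≤ r) (hr0 : 0 ≤ r)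
    (hr : r < 1) : ((1 + X) * (1 - X)⁻¹ + (1 + Y) * (1 - Y)⁻¹).det ≠ 0 := by
  refine det_ne_zero_of_vnorm fun u hu h => ?_
  have := vnorm_cayley_add_ge hX hY hr0 hr u
  rw [h, vnorm_zero, mul_zero] at this
  exact (vnorm_pos hu).not_ge this

/-- The supremum is attained at `X = Y = -rI`, where both Cayley transforms are the scalar `(1 -
r)/(1 + r)`. -/
theorem isGreatest_combConst (hr0 : 0 ≤ r) (hr : r < 1) :
    IsGreatest {t | ∃ X Y : Blk n, opNorm X ≤ r ∧ opNorm Y ≤ r ∧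
      t = opNorm (((1 + X) * (1 - X)⁻¹ + (1 + Y) * (1 - Y)⁻¹)⁻¹)} ((1 + r) / (2 * (1 - r))) := by
  have h5 : 0 < 1 + r := by linarith
  have h6 : 0 < 1 - r := by linarith
  constructor
  · have hX : opNorm (-(r : ℂ) • (1 : Blk n)) ≤ r := by
      rw [opNorm_smul, opNorm_one, norm_neg, Complex.norm_real, Real.norm_of_nonneg hr0, mul_one]
    refine ⟨_, _, hX, hX, ?_⟩
    have h5' : (1 + r : ℂ) ≠ 0 := by exact_mod_cast h5.ne'
    have h6' : (1 - r : ℂ) ≠ 0 := by exact_mod_cast h6.ne'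
    have e1 : (1 - -(r : ℂ) • (1 : Blk n))⁻¹ = (1 + r : ℂ)⁻¹ • 1 := by
      apply Matrix.inv_eq_left_inv
      rw [show (1 - -(r : ℂ) • (1 : Blk n)) = (1 + r : ℂ) • 1 by module, smul_mul_smul_comm,
        inv_mul_cancel₀ h5', one_smul, one_mul]
    have e2 : (1 + -(r : ℂ) • (1 : Blk n)) = (1 - r : ℂ) • 1 := by module
    have e3 : ((1 - r : ℂ) • (1 : Blk n) * ((1 + r : ℂ)⁻¹ • 1) +
        (1 - r : ℂ) • (1 : Blk n) * ((1 + r : ℂ)⁻¹ • 1))⁻¹ =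
        (((1 + r) / (2 * (1 - r)) : ℝ) : ℂ) • 1 := by
      apply Matrix.inv_eq_left_inv
      rw [smul_mul_smul_comm, mul_one, ← add_smul, smul_mul_smul_comm, mul_one]
      push_cast
      convert one_smul ℂ (1 : Blk n)
      field_simp
      ring
    rw [e1, e2, e3, opNorm_smul, opNorm_one, Complex.norm_real, mul_one,
      Real.norm_of_nonneg (by positivity)]
  · rintro _ ⟨X, Y, hX, hY, rfl⟩
    exact opNorm_inv_le (by positivity) (det_cayley_add_ne_zero hX hY hr0 hr)
      (vnorm_cayley_add_ge hX hY hr0 hr)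

theorem combConst_eq (hr0 : 0 ≤ r) (hr : r < 1) : combConst n r = (1 + r) / (2 * (1 - r)) :=
  (isGreatest_combConst hr0 hr).csSup_eq

theorem opNorm_cayley_add_inv_le {X Y : Blk n} (hX : opNorm X ≤ r) (hY : opNorm Y ≤ r)
    (hr0 : 0 ≤ r) (hr : r < 1) :
    opNorm ((1 + X) * (1 - X)⁻¹ + (1 + Y) * (1 - Y)⁻¹)⁻¹ ≤ combConst n r := by
  rw [combConst_eq hr0 hr]
  exact (isGreatest_combConst hr0 hr).2 ⟨X, Y, hX, hY, rfl⟩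

theorem combConst_nonneg (hr0 : 0 ≤ r) (hr : r < 1) : 0 ≤ combConst n r := by
  rw [combConst_eq hr0 hr]
  exact div_nonneg (by linarith) (by linarith)

theorem tendsto_combConst (n : ℕ) : Tendsto (combConst n) (𝓝[>] 0) (𝓝 2⁻¹) := by
  have h1 : Tendsto (fun r : ℝ => (1 + r) / (2 * (1 - r))) (𝓝[>] 0) (𝓝 2⁻¹) := by
    have : ContinuousAt (fun r : ℝ => (1 + r) / (2 * (1 - r))) 0 := by
      refine ContinuousAt.div (by fun_prop) (by fun_prop) (by norm_num)
    refine Tendsto.mono_left ?_ nhdsWithin_le_nhds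
    simpa [ContinuousAt] using this
  refine h1.congr' ?_
  filter_upwards [Ioo_mem_nhdsGT (zero_lt_one (α := ℝ))] with r hr
  exact (combConst_eq hr.1.le hr.2).symm

/-- `K_r < 1` means `r < 1/3`. It is needed only in this weaker form, which says that the factor
`r/(1 - r²)` of a letter is less than `1`. -/
theorem lt_of_combConst_lt_one (hr0 : 0 ≤ r) (hr : r < 1) (h : combConst n r < 1) :
    r < 1 - r ^ 2 := by
  rw [combConst_eq hr0 hr, div_lt_one (by linarith)] at h
  nlinarith

end CombConst

/-! ### The elements of the two factors -/

section Letters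

variable {n : ℕ} {r : ℝ} {M : Matrix (Idx n) (Idx n) ℂ} {g : PGLGroup n}

theorem eventually_sndPart_le {Γ : Subgroup (PGLGroup n)} {a : ℝ} (ha : 0 < a)
    (hF : {p : PSpace n | r * sndNorm p ≤ fstNorm p} ⊆
      (fun p : PSpace n => alpha n a ha • p) '' fRegion Γ)
    (hg : g ∈ conj (alpha n a ha) Γ) (hg1 : g ≠ 1) (hM : IsRep M g) {v : Idx n → ℂ} (hv : v ≠ 0)
    (hvr : r * vnorm (sndPart v) ≤ vnorm (fstPart v)) :
    ∀ᶠ u in 𝓝 v, vnorm (sndPart u) ≤ vnorm (sndPart (M.mulVec u)) := by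
  obtain ⟨h, hh, rfl⟩ := mem_conj.1 hg
  rw [Ne, conj_eq_one_iff] at hg1
  have hN := isRep_slRep h
  obtain ⟨ζ, hζ, hMN⟩ := (hN.conj_alpha ha).exists_unit_smul hM
  have ha0 : (a : ℂ) ≠ 0 := Complex.ofReal_ne_zero.mpr ha.ne'
  obtain ⟨hv', hαv⟩ := alpha_smul_mk ha hv
  have hmem : (Projectivization.mk ℂ _ hv' : PSpace n) ∈ fRegion Γ := by
    obtain ⟨q, hq, hqv⟩ := hF ((mk_mem_closedTube_iff hv).2 hvr)
    rw [← hαv] at hqv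
    rwa [← MulAction.injective (alpha n a ha) hqv]
  have hev := eventually_mk_mem isOpen_interior hv' hmem
  have hcont : Continuous fun u : Idx n → ℂ =>
      Sum.elim ((a : ℂ)⁻¹ • fstPart u) ((a : ℂ) • sndPart u) := by
    refine continuous_pi fun i => ?_
    rcases i with i | i <;> simp only [Sum.elim_inl, Sum.elim_inr, fstPart, sndPart, Pi.smul_apply]
      <;> fun_prop
  filter_upwards [hcont.continuousAt.eventually hev] with u ⟨hu, hu'⟩
  have h1 := Set.mem_iInter₂.1 (interior_subset hu') h ⟨hh, hg1⟩
  rw [hN.mem_deltaBar_mk_iff] at h1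
  rw [sndPart_elim, vnorm_smul, sndPart_mulVec, fstPart_elim, sndPart_elim] at h1
  rw [hMN, Matrix.smul_mulVec, sndPart_smul, vnorm_smul, hζ, one_mul, sndPart_mulVec,
    Matrix.toBlocks_fromBlocks₂₁, Matrix.toBlocks_fromBlocks₂₂]
  have h2 : (slRep h).toBlocks₂₁.mulVec ((a : ℂ)⁻¹ • fstPart u) +
      (slRep h).toBlocks₂₂.mulVec ((a : ℂ) • sndPart u) =
      (a : ℂ) • ((((a : ℂ)⁻¹ ^ 2) • (slRep h).toBlocks₂₁).mulVec (fstPart u) +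
        (slRep h).toBlocks₂₂.mulVec (sndPart u)) := by
    rw [smul_add, Matrix.smul_mulVec, Matrix.mulVec_smul, Matrix.mulVec_smul, smul_smul]
    congr 2
    field_simp
  rw [h2, vnorm_smul] at h1
  exact le_of_mul_le_mul_left h1 (norm_pos_iff.2 ha0)

/-- `F`-regions in terms of representatives: the condition `‖z''‖ ≤ ‖C z' + D z''‖` holds near
every `z` with `‖z'‖ ≥ r ‖z''‖`. -/
def ExpandsTube (r : ℝ) (M : Matrix (Idx n) (Idx n) ℂ) : Prop :=
  ∀ v, v ≠ 0 → r * vnorm (sndPart v) ≤ vnorm (fstPart v) →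
    ∀ᶠ u in 𝓝 v, vnorm (sndPart u) ≤ vnorm (sndPart (M.mulVec u))

namespace ExpandsTube

theorem le (h : ExpandsTube r M) {v : Idx n → ℂ}
    (hv : r * vnorm (sndPart v) ≤ vnorm (fstPart v)) :
    vnorm (sndPart v) ≤ vnorm (sndPart (M.mulVec v)) := by
  by_cases hv0 : v = 0
  · simp [hv0]
  · exact (h v hv0 hv).self_of_nhds

/-- The vector with parts `C⁻¹u - C⁻¹D y` and `y` is the one on which `Cz' + Dz''` takes the value
`u`. Were its first part large, the expansion would give `‖y‖ ≤ ‖u‖`. -/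
theorem sub_lt (h : ExpandsTube r M) (hC : M.toBlocks₂₁.det ≠ 0) {u y : Fin (n + 1) → ℂ}
    (huy : vnorm u < vnorm y) :
    vnorm (M.toBlocks₂₁⁻¹.mulVec u - (M.toBlocks₂₁⁻¹ * M.toBlocks₂₂).mulVec y) < r * vnorm y := by
  by_contra! hle
  have := h.le (v := Sum.elim
    (M.toBlocks₂₁⁻¹.mulVec u - (M.toBlocks₂₁⁻¹ * M.toBlocks₂₂).mulVec y) y) (by simpa using hle)
  rw [sndPart_mulVec, fstPart_elim, sndPart_elim, Matrix.mulVec_sub, mulVec_inv_cancel hC,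
    ← Matrix.mulVec_mulVec, mulVec_inv_cancel hC, sub_add_cancel] at this
  exact this.not_gt huy

theorem vnorm_inv_mul_le (h : ExpandsTube r M) (hC : M.toBlocks₂₁.det ≠ 0)
    (y : Fin (n + 1) → ℂ) :
    vnorm ((M.toBlocks₂₁⁻¹ * M.toBlocks₂₂).mulVec y) ≤ r * vnorm y := by
  by_cases hy : y = 0
  · simp [hy]
  · simpa using (h.sub_lt hC (u := 0) (by simpa using vnorm_pos hy)).le

/-- Both `C⁻¹u` and `-C⁻¹u` lie within `r‖y‖` of `C⁻¹D y` whenever `‖u‖ < ‖y‖`, so their distance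
`2‖C⁻¹u‖` is less than `2r‖y‖`. Take `y = tu` and let `t` decrease to `1`. -/
theorem opNorm_inv_le (h : ExpandsTube r M) (hr : 0 < r) (hC : M.toBlocks₂₁.det ≠ 0) :
    opNorm M.toBlocks₂₁⁻¹ ≤ r := by
  refine opNorm_le hr.le fun u => ?_
  by_cases hu : u = 0
  · simp [hu]
  have hu' := vnorm_pos hu
  refine le_of_forall_pos_le_add fun ε hε => ?_
  set t : ℝ := 1 + ε / (r * vnorm u)
  have ht : 1 < t := by
    have : 0 < ε / (r * vnorm u) := by positivity
    simp only [t]; linarith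
  have hy : vnorm ((t : ℂ) • u) = t * vnorm u := by
    rw [vnorm_smul, Complex.norm_real, Real.norm_of_nonneg (by linarith)]
  have hlt : vnorm u < vnorm ((t : ℂ) • u) := by
    rw [hy]; nlinarith
  have h1 := h.sub_lt hC hlt
  have h2 := h.sub_lt hC (u := -u) (y := (t : ℂ) • u) (by rwa [vnorm_neg])
  set d := (M.toBlocks₂₁⁻¹ * M.toBlocks₂₂).mulVec ((t : ℂ) • u)
  have h3 := vnorm_sub_le (M.toBlocks₂₁⁻¹.mulVec u - d) (M.toBlocks₂₁⁻¹.mulVec (-u) - d)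
  have h4 : M.toBlocks₂₁⁻¹.mulVec u - d - (M.toBlocks₂₁⁻¹.mulVec (-u) - d) =
      (2 : ℂ) • M.toBlocks₂₁⁻¹.mulVec u := by
    rw [Matrix.mulVec_neg, two_smul]; abel
  rw [h4, vnorm_smul, Complex.norm_ofNat] at h3
  rw [hy] at h1 h2
  have h5 : r * (t * vnorm u) = r * vnorm u + ε := by
    simp only [t]; field_simp
  linarith

/-- If both `v` and `Mv` had a large first part, expansion under `M` at `v` and under `M⁻¹` at `Mv`
would give equality of the norms of their second parts. Equality is impossible because expansion
holds in a whole neighbourhood of `v`; this is where the interior in the definition of the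
`F`-region matters. -/
theorem maps (h : ExpandsTube r M) (h' : ExpandsTube r M⁻¹) (hM : IsRep M g)
    (hC : M.toBlocks₂₁.det ≠ 0) {v : Idx n → ℂ} (hv : v ≠ 0)
    (hvr : r * vnorm (sndPart v) ≤ vnorm (fstPart v)) :
    vnorm (fstPart (M.mulVec v)) < r * vnorm (sndPart (M.mulVec v)) := by
  by_contra! hle
  have h1 := h'.le hle
  rw [inv_mulVec_cancel (by rw [hM.1]; exact one_ne_zero)] at h1
  have h2 := h.le hvr
  set w := sndPart (M.mulVec v) with hw
  -- Along this path `z''` is constant and `Cz' + Dz''` shrinks to `(1 - t)w`, so expansion for a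
  -- small `t > 0` forces `w = 0`, and then `v = 0`.
  let path : ℝ → Idx n → ℂ := fun t =>
    Sum.elim (fstPart v - (t : ℂ) • M.toBlocks₂₁⁻¹.mulVec w) (sndPart v)
  have hpath : Continuous path := by
    refine continuous_pi fun i => ?_
    rcases i with i | i <;> simp only [path, Sum.elim_inl, Sum.elim_inr, Pi.sub_apply,
      Pi.smul_apply] <;> fun_prop
  have hpath0 : path 0 = v := by simp [path]
  have hval : ∀ t, sndPart (M.mulVec (path t)) = ((1 - t : ℝ) : ℂ) • w := by
    intro t
    rw [sndPart_mulVec, fstPart_elim, sndPart_elim, Matrix.mulVec_sub, Matrix.mulVec_smul,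
      mulVec_inv_cancel hC, sub_add_eq_add_sub, ← sndPart_mulVec, ← hw]
    push_cast
    module
  have hev : ∀ᶠ t in 𝓝 (0 : ℝ),
      vnorm (sndPart (path t)) ≤ vnorm (sndPart (M.mulVec (path t))) := by
    have := h v hv hvr
    rw [← hpath0] at this
    exact hpath.continuousAt.eventually this
  obtain ⟨t, ht, ht0, ht1⟩ := ((hev.filter_mono nhdsWithin_le_nhds).and
    (Ioo_mem_nhdsGT (zero_lt_one (α := ℝ)))).exists
  rw [hval, vnorm_smul, Complex.norm_real, Real.norm_of_nonneg (by linarith)] at ht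
  change vnorm (sndPart v) ≤ _ at ht
  have hw0 : vnorm w = 0 := by nlinarith [vnorm_nonneg w]
  have hv0 : sndPart v = 0 := vnorm_eq_zero.1 (le_antisymm (h2.trans hw0.le) (vnorm_nonneg _))
  rw [vnorm_eq_zero, hw, sndPart_mulVec, hv0, Matrix.mulVec_zero, add_zero] at hw0
  refine hv (eq_zero_of_parts ?_ hv0)
  rw [← inv_mulVec_cancel hC (fstPart v), hw0, Matrix.mulVec_zero]

end ExpandsTube

/-- The part of `z` that is large on the image of the elements of the first factor (`b = true`),
respectively the second factor (`b = false`), in the original coordinates. -/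
def domPart (b : Bool) (v : Idx n → ℂ) : Fin (n + 1) → ℂ := cond b (sndPart v) (fstPart v)

/-- The contraction property of the elements of a factor, in the original coordinates. -/
structure IsLetter (r c : ℝ) (b : Bool) (M : Matrix (Idx n) (Idx n) ℂ) : Prop where
  lower : ∀ v, vnorm (domPart (!b) v) - r * vnorm (domPart b v) ≤ c * vnorm (domPart b (M.mulVec v))
  maps : ∀ v, v ≠ 0 → r * vnorm (domPart b v) ≤ vnorm (domPart (!b) v) →
    vnorm (domPart (!b) (M.mulVec v)) < r * vnorm (domPart b (M.mulVec v))

/-- By (♣) the relevant values lie in the compact interval `[ε, b]`, which is covered by finitely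
many of the neighbourhoods from (♠). -/
theorem Spade.finite_le_radius {Γ : Subgroup (PGLGroup n)} (hs : Spade Γ) (hc : Club Γ) {ε : ℝ}
    (hε : 0 < ε) : {g | g ∈ Γ ∧ g ≠ 1 ∧ ε ≤ radius g}.Finite := by
  obtain ⟨b, hb⟩ := hc
  have : {g | g ∈ Γ ∧ g ≠ 1 ∧ radius g ∈ Set.Icc ε b}.Finite := by
    refine isCompact_Icc.induction_on (p := fun s => {g | g ∈ Γ ∧ g ≠ 1 ∧ radius g ∈ s}.Finite)
      (by simp) (fun s t hst ht => ht.subset fun g hg => ⟨hg.1, hg.2.1, hst hg.2.2⟩)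
      (fun s t h1 h2 => (h1.union h2).subset ?_) ?_
    · rintro g ⟨h1, h2, h3 | h3⟩
      · exact Or.inl ⟨h1, h2, h3⟩
      · exact Or.inr ⟨h1, h2, h3⟩
    · intro x hx
      obtain ⟨δ, hδ, hfin⟩ := hs x (hε.trans_le hx.1).ne'
      refine ⟨Metric.ball x δ, mem_nhdsWithin_of_mem_nhds (Metric.ball_mem_nhds x hδ), ?_⟩
      simpa only [Metric.mem_ball, Real.dist_eq] using hfin
  exact this.subset fun g hg => ⟨hg.1, hg.2.1, hg.2.2, hb g hg.1 hg.2.1⟩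

theorem det_blockC_conj_alpha_ne_zero {Γ : Subgroup (PGLGroup n)} (hadm : AdmissibleCoordinates Γ)
    {a : ℝ} (ha : 0 < a) {h : PGLGroup n} (hh : h ∈ Γ) (hh1 : h ≠ 1) :
    (blockC (alpha n a ha * h * (alpha n a ha)⁻¹)).det ≠ 0 := by
  obtain ⟨R, hR, hm⟩ := hadm.exists_movesTube
  have hM := isRep_slRep h
  have hC := (hm h hh hh1 _ hM).det_ne_zero hM
  rw [(hM.conj_alpha ha).det_blockC_ne_zero_iff, Matrix.toBlocks_fromBlocks₂₁, Matrix.det_smul]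
  simp [hC, ha.ne']

/-- A rescaled group: the elements other than `1` are letters, whose sizes tend to `0`. -/
theorem isLetter_conj_alpha {Γ : Subgroup (PGLGroup n)} (hadm : AdmissibleCoordinates Γ)
    {a : ℝ} (ha : 0 < a) (hr : 0 < r)
    (hF : {p : PSpace n | r * sndNorm p ≤ fstNorm p} ⊆
      (fun p : PSpace n => alpha n a ha • p) '' fRegion Γ)
    (hg : g ∈ conj (alpha n a ha) Γ) (hg1 : g ≠ 1) (hM : IsRep M g) :
    radius g ≤ r ∧ IsLetter r (radius g) true M := by
  have hE : ExpandsTube r M := fun v hv hvr => eventually_sndPart_le ha hF hg hg1 hM hv hvr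
  have hE' : ExpandsTube r M⁻¹ := fun v hv hvr =>
    eventually_sndPart_le ha hF (inv_mem hg) (inv_ne_one.2 hg1) hM.inv hv hvr
  have hC : M.toBlocks₂₁.det ≠ 0 := by
    rw [← hM.det_blockC_ne_zero_iff]
    obtain ⟨h, hh, rfl⟩ := mem_conj.1 hg
    exact det_blockC_conj_alpha_ne_zero hadm ha hh fun h1 => hg1 (by simp [h1])
  rw [hM.radius_eq]
  exact ⟨hE.opNorm_inv_le hr hC, fun v => vnorm_fst_sub_le hC (hE.vnorm_inv_mul_le hC) v,
    fun v hv hvr => hE.maps hE' hM hC hv hvr⟩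

theorem finite_le_radius_conj_alpha {Γ : Subgroup (PGLGroup n)}
    (hc : Club Γ) (hs : Spade Γ) {a : ℝ} (ha : 0 < a) {ε : ℝ} (hε : 0 < ε) :
    {g | g ∈ conj (alpha n a ha) Γ ∧ g ≠ 1 ∧ ε ≤ radius g}.Finite := by
  refine ((hs.finite_le_radius hc (ε := ε / a ^ 2) (by positivity)).image
    fun h => alpha n a ha * h * (alpha n a ha)⁻¹).subset ?_
  rintro g ⟨hg, hg1, hge⟩
  obtain ⟨h, hh, rfl⟩ := mem_conj.1 hg
  have hh1 : h ≠ 1 := fun h1 => hg1 (by simp [h1])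
  rw [radius_conj_alpha] at hge
  exact ⟨h, ⟨hh, hh1, by rw [div_le_iff₀ (by positivity)]; linarith⟩, rfl⟩

theorem IsLetter.swap {c : ℝ} (h : IsLetter r c true M) :
    IsLetter r c false
      (Matrix.fromBlocks M.toBlocks₂₂ M.toBlocks₂₁ M.toBlocks₁₂ M.toBlocks₁₁) := by
  set N := Matrix.fromBlocks M.toBlocks₂₂ M.toBlocks₂₁ M.toBlocks₁₂ M.toBlocks₁₁ with hN
  have h1 : ∀ v, fstPart (N.mulVec v) = sndPart (M.mulVec (Sum.elim (sndPart v) (fstPart v))) := by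
    intro v
    rw [fstPart_mulVec, sndPart_mulVec, hN, Matrix.toBlocks_fromBlocks₁₁,
      Matrix.toBlocks_fromBlocks₁₂]
    exact add_comm _ _
  have h2 : ∀ v, sndPart (N.mulVec v) = fstPart (M.mulVec (Sum.elim (sndPart v) (fstPart v))) := by
    intro v
    rw [fstPart_mulVec, sndPart_mulVec, hN, Matrix.toBlocks_fromBlocks₂₁,
      Matrix.toBlocks_fromBlocks₂₂]
    exact add_comm _ _
  constructor
  · intro v
    have := h.lower (Sum.elim (sndPart v) (fstPart v))
    simp only [domPart, cond_true, cond_false, Bool.not_true, Bool.not_false] at this ⊢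
    rw [h1]
    exact this
  · intro v hv hvr
    have := h.maps (Sum.elim (sndPart v) (fstPart v)) (fun h0 => hv (eq_zero_of_parts
      (by simpa using congrArg sndPart h0) (by simpa using congrArg fstPart h0))) hvr
    simp only [domPart, cond_true, cond_false, Bool.not_true, Bool.not_false] at this ⊢
    rw [h1, h2]
    exact this

/-- `M` represents `τ⁻¹ g τ`. -/
def IsTauRep (M : Matrix (Idx n) (Idx n) ℂ) (g : PGLGroup n) : Prop :=
  IsRep M ((tau n)⁻¹ * g * tau n)

theorem IsTauRep.mul {N : Matrix (Idx n) (Idx n) ℂ} {h : PGLGroup n} (hM : IsTauRep M g)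
    (hN : IsTauRep N h) : IsTauRep (M * N) (g * h) := by
  have := IsRep.mul hM hN
  unfold IsTauRep
  convert this using 1
  group

theorem IsTauRep.isRep (hM : IsTauRep M g) : IsRep (tauConj M) g := by
  have := IsRep.conj_tau hM
  convert this using 1
  group

/-- The two factors of a combination: their elements other than `1` are letters, whose sizes
tend to `0`. -/
structure IsLetterSystem (r : ℝ) (H : Bool → Subgroup (PGLGroup n))
    (size : Bool → PGLGroup n → ℝ) : Prop where
  size_nonneg : ∀ b g, 0 ≤ size b g
  size_le : ∀ b, ∀ g ∈ H b, g ≠ 1 → size b g ≤ r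
  isLetter : ∀ b, ∀ g ∈ H b, g ≠ 1 → ∃ M, IsTauRep M g ∧ IsLetter r (size b g) b M
  finite : ∀ b, ∀ ε : ℝ, 0 < ε → {g | g ∈ H b ∧ g ≠ 1 ∧ ε ≤ size b g}.Finite

theorem exists_isLetterSystem {Γ₁ Γ₂ : Subgroup (PGLGroup n)}
    (hadm₁ : AdmissibleCoordinates Γ₁) (hadm₂ : AdmissibleCoordinates Γ₂)
    (hclub₁ : Club Γ₁) (hclub₂ : Club Γ₂) (hspade₁ : Spade Γ₁) (hspade₂ : Spade Γ₂)
    (hr : 0 < r) {a : ℝ} (ha : 0 < a) (hs : Suitable Γ₁ Γ₂ r a ha) :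
    ∃ size, IsLetterSystem r
      (fun b => cond b (firstFactor Γ₁ a ha) (secondFactor Γ₂ a ha)) size := by
  have hF₁ := hs.1.trans (Set.image_mono Set.inter_subset_left)
  have hF₂ := hs.1.trans (Set.image_mono Set.inter_subset_right)
  -- The size of a letter is its `‖C⁻¹‖` in the rescaled group it comes from, with `τ`, and for the
  -- second factor also `σ`, undone.
  refine ⟨fun b g => cond b (radius ((tau n)⁻¹ * g * tau n))
    (radius ((sigma n)⁻¹ * ((tau n)⁻¹ * g * tau n) * sigma n)), ?_, ?_, ?_, ?_⟩
  · rintro (_ | _) g <;> exact opNorm_nonneg _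
  · rintro (_ | _) g hg hg1
    · obtain ⟨_, ⟨k, hk, rfl⟩, rfl⟩ := hg
      have hk1 : k ≠ 1 := by rintro rfl; simp at hg1
      have := (isLetter_conj_alpha hadm₂ ha hr hF₂ hk hk1 (isRep_slRep k)).1
      simpa [mul_assoc] using this
    · obtain ⟨k, hk, rfl⟩ := hg
      have hk1 : k ≠ 1 := by rintro rfl; simp at hg1
      have := (isLetter_conj_alpha hadm₁ ha hr hF₁ hk hk1 (isRep_slRep k)).1
      simpa [mul_assoc] using this
  · rintro (_ | _) g hg hg1
    · obtain ⟨_, ⟨k, hk, rfl⟩, rfl⟩ := hg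
      have hk1 : k ≠ 1 := by rintro rfl; simp at hg1
      have := (isLetter_conj_alpha hadm₂ ha hr hF₂ hk hk1 (isRep_slRep k)).2.swap
      refine ⟨_, ?_, by simpa [mul_assoc] using this⟩
      have h2 := (isRep_slRep k).conj_sigma
      unfold IsTauRep
      convert h2 using 1
      simp [mul_assoc]
    · obtain ⟨k, hk, rfl⟩ := hg
      have hk1 : k ≠ 1 := by rintro rfl; simp at hg1
      have := (isLetter_conj_alpha hadm₁ ha hr hF₁ hk hk1 (isRep_slRep k)).2
      refine ⟨_, ?_, by simpa [mul_assoc] using this⟩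
      have h2 := isRep_slRep k
      unfold IsTauRep
      convert h2 using 1
      simp [mul_assoc]
  · rintro (_ | _) ε hε
    · refine ((finite_le_radius_conj_alpha hclub₂ hspade₂ ha hε).image
        fun k => tau n * (sigma n * k * (sigma n)⁻¹) * (tau n)⁻¹).subset ?_
      rintro _ ⟨⟨_, ⟨k, hk, rfl⟩, rfl⟩, hg1, hge⟩
      exact ⟨k, ⟨hk, by rintro rfl; simp at hg1, by simpa [mul_assoc] using hge⟩, rfl⟩
    · refine ((finite_le_radius_conj_alpha hclub₁ hspade₁ ha hε).image
        fun k => tau n * k * (tau n)⁻¹).subset ?_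
      rintro _ ⟨⟨k, hk, rfl⟩, hg1, hge⟩
      exact ⟨k, ⟨hk, by rintro rfl; simp at hg1, by simpa [mul_assoc] using hge⟩, rfl⟩

end Letters

/-! ### Alternating words -/

section Words

variable {G : Type*} [Group G]

/-- `Word H b l`: the list `l` is an alternating product of elements other than `1` of `H true` and
`H false`, whose first entry belongs to `H b`. -/
inductive Word (H : Bool → Subgroup G) : Bool → List G → Prop
  | single {b : Bool} {g : G} : g ∈ H b → g ≠ 1 → Word H b [g]
  | cons {b : Bool} {g : G} {l : List G} : g ∈ H b → g ≠ 1 → Word H (!b) l → Word H b (g :: l)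

variable {H : Bool → Subgroup G}

theorem Word.map {G' : Type*} [Group G'] {H' : Bool → Subgroup G'} {φ : G →* G'}
    (hmem : ∀ b, ∀ g ∈ H b, φ g ∈ H' b) (hne : ∀ b, ∀ g ∈ H b, g ≠ 1 → φ g ≠ 1) {b : Bool}
    {l : List G} (h : Word H b l) : Word H' b (l.map φ) := by
  induction h with
  | single hg hg1 => exact .single (hmem _ _ hg) (hne _ _ hg hg1)
  | cons hg hg1 _ ih => exact .cons (hmem _ _ hg) (hne _ _ hg hg1) ih

/-- This is the reduction step: `g` is prepended if it belongs to the other factor and otherwise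
merged with the first letter, which disappears if the product is `1`. -/
theorem Word.exists_mul {b b' : Bool} {g : G} {l : List G} (hg : g ∈ H b) (h : Word H b' l) :
    g * l.prod = 1 ∨ ∃ c l', Word H c l' ∧ l'.prod = g * l.prod := by
  by_cases hg1 : g = 1
  · exact Or.inr ⟨b', l, h, by simp [hg1]⟩
  by_cases hb : b' = !b
  · subst hb
    exact Or.inr ⟨b, g :: l, .cons hg hg1 h, by simp⟩
  obtain rfl : b' = b := by cases b <;> cases b' <;> simp_all
  cases h with
  | single hk hk1 =>
    rename_i k
    by_cases hgk : g * k = 1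
    · exact Or.inl (by simpa using hgk)
    · exact Or.inr ⟨_, [g * k], .single (mul_mem hg hk) hgk, by simp⟩
  | cons hk hk1 ht =>
    rename_i k t
    by_cases hgk : g * k = 1
    · exact Or.inr ⟨_, t, ht, by rw [List.prod_cons, ← mul_assoc, hgk, one_mul]⟩
    · exact Or.inr ⟨_, (g * k) :: t, .cons (mul_mem hg hk) hgk ht, by simp [mul_assoc]⟩

theorem eq_one_or_exists_word {x : G} (hx : x ∈ H true ⊔ H false) :
    x = 1 ∨ ∃ b l, Word H b l ∧ l.prod = x := by
  have step : ∀ b, ∀ g ∈ H b, ∀ y : G, (y = 1 ∨ ∃ b l, Word H b l ∧ l.prod = y) →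
      g * y = 1 ∨ ∃ b l, Word H b l ∧ l.prod = g * y := by
    rintro b g hg y (rfl | ⟨b', l, hl, rfl⟩)
    · by_cases hg1 : g = 1
      · exact Or.inl (by simp [hg1])
      · exact Or.inr ⟨b, [g], .single hg hg1, by simp⟩
    · exact hl.exists_mul hg
  rw [Subgroup.sup_eq_closure] at hx
  induction hx using Subgroup.closure_induction_left with
  | one => exact Or.inl rfl
  | mul_left g hg y _ ih =>
    rcases hg with hg | hg
    · exact step true g hg y ih
    · exact step false g hg y ih
  | inv_mul_cancel g hg y _ ih =>
    rcases hg with hg | hg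
    · exact step true _ (inv_mem hg) y ih
    · exact step false _ (inv_mem hg) y ih

/-- Trivial intersection ensures that each entry lies in only one factor, so that the types read off
from neighbouring pairs are consistent. -/
theorem IsNormalForm.exists_word (hd : ∀ g, g ∈ H true → g ∈ H false → g = 1) {l : List G}
    (h : IsNormalForm (H true) (H false) l) : ∃ b, Word H b l := by
  obtain ⟨h0, h1, h2⟩ := h
  induction l with
  | nil => exact absurd rfl h0
  | cons g t ih =>
    obtain ⟨hg1, hg⟩ := h1 g (by simp)
    match t, ih, h1, h2 with
    | [], _, _, _ =>
      rcases hg with hg | hg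
      · exact ⟨_, .single hg hg1⟩
      · exact ⟨_, .single hg hg1⟩
    | k :: t, ih, h1, h2 =>
      obtain ⟨hgk, h2⟩ := List.isChain_cons_cons.1 h2
      obtain ⟨b, hb⟩ := ih (by simp) (fun x hx => h1 x (List.mem_cons_of_mem _ hx)) h2
      have hk : k ∈ H b := by cases hb <;> assumption
      have hk1 : k ≠ 1 := (h1 k (by simp)).1
      refine ⟨!b, .cons ?_ hg1 (by simpa using hb)⟩
      rcases hgk with ⟨hg, hk'⟩ | ⟨hg, hk'⟩
      · cases b
        · exact hg
        · exact absurd (hd k hk hk') hk1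
      · cases b
        · exact absurd (hd k hk' hk) hk1
        · exact hg

/-- A criterion for free products: no alternating product is trivial. -/
theorem isInternalFreeProduct_of_word (h : ∀ b l, Word H b l → l.prod ≠ 1) :
    IsInternalFreeProduct (H true) (H false) (H true ⊔ H false) := by
  refine ⟨(injective_iff_map_eq_one _).2 fun x hx => ?_, by simp [Monoid.Coprod.range_lift]⟩
  -- The two canonical copies generate the coproduct, so an element of the kernel is `1` or a word
  -- in them. The canonical map is injective on each copy and hence maps words to words.
  let H' : Bool → Subgroup (Monoid.Coprod (H true) (H false)) := fun b =>
    match b with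
    | true => MonoidHom.range Monoid.Coprod.inl
    | false => MonoidHom.range Monoid.Coprod.inr
  have hx' : x ∈ H' true ⊔ H' false := by
    simp only [H', Monoid.Coprod.range_inl_sup_range_inr, Subgroup.mem_top]
  rcases eq_one_or_exists_word hx' with rfl | ⟨b, l, hl, rfl⟩
  · rfl
  refine absurd ?_ (h b _ (hl.map (H' := H)
    (φ := Monoid.Coprod.lift (H true).subtype (H false).subtype) ?_ ?_))
  · rw [← map_list_prod, hx]
  · rintro (_ | _) _ ⟨k, rfl⟩
    · simp
    · simp
  · rintro (_ | _) _ ⟨k, rfl⟩ hk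
    · simp only [Monoid.Coprod.lift_apply_inr, Subgroup.coe_subtype]
      rintro h1
      exact hk (by rw [Subtype.ext (a2 := (1 : H _)) h1, map_one])
    · simp only [Monoid.Coprod.lift_apply_inl, Subgroup.coe_subtype]
      rintro h1
      exact hk (by rw [Subtype.ext (a2 := (1 : H _)) h1, map_one])

/-- The product of the values of `q` on the entries of a word. -/
def wordSize {G : Type*} (q : Bool → G → ℝ) : Bool → List G → ℝ
  | _, [] => 1
  | b, g :: l => q b g * wordSize q (!b) l

theorem wordSize_nonneg {G : Type*} {q : Bool → G → ℝ} (hq : ∀ b g, 0 ≤ q b g) (b : Bool) (l : List G) :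
    0 ≤ wordSize q b l := by
  induction l generalizing b with
  | nil => exact zero_le_one
  | cons g l ih => exact mul_nonneg (hq b g) (ih _)

theorem Word.wordSize_le {q : Bool → G → ℝ} (hq : ∀ b g, 0 ≤ q b g) {k : ℝ} (hk : 0 ≤ k)
    (hqk : ∀ b, ∀ g ∈ H b, g ≠ 1 → q b g ≤ k) {b : Bool} {l : List G} (h : Word H b l) :
    wordSize q b l ≤ k ^ l.length := by
  induction h with
  | single hg hg1 => simpa [wordSize] using hqk _ _ hg hg1
  | cons hg hg1 _ ih =>
    rw [List.length_cons, pow_succ']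
    exact mul_le_mul (hqk _ _ hg hg1) ih (wordSize_nonneg hq _ _) hk

/-- All factors are at most `1`, so the product is at most each of them. -/
theorem Word.le_of_le_wordSize {q : Bool → G → ℝ} (hq : ∀ b g, 0 ≤ q b g)
    (hq1 : ∀ b, ∀ g ∈ H b, g ≠ 1 → q b g ≤ 1) {ε : ℝ} {b : Bool} {l : List G} (h : Word H b l)
    (hε : ε ≤ wordSize q b l) : ∀ g ∈ l, ∃ b, g ∈ H b ∧ g ≠ 1 ∧ ε ≤ q b g := by
  induction h with
  | single hg hg1 =>
    simp only [wordSize, mul_one] at hε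
    exact fun k hk => List.mem_singleton.1 hk ▸ ⟨_, hg, hg1, hε⟩
  | @cons b k t hk hk1 ht ih =>
    have h1 := wordSize_nonneg hq (!b) t
    have h2 : wordSize q (!b) t ≤ 1 := by
      simpa using ht.wordSize_le hq zero_le_one hq1
    have h3 := hq b k
    have h4 := hq1 b k hk hk1
    change ε ≤ q b k * wordSize q (!b) t at hε
    intro g hg
    rcases List.mem_cons.1 hg with rfl | hg
    · exact ⟨b, hk, hk1, by nlinarith⟩
    · exact ih (by nlinarith) g hg

/-- Only finitely many words have a size that is not small. -/
theorem finite_prod_of_le_wordSize {q : Bool → G → ℝ} (hq : ∀ b g, 0 ≤ q b g) {k : ℝ} (hk : 0 ≤ k)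
    (hk1 : k < 1) (hqk : ∀ b, ∀ g ∈ H b, g ≠ 1 → q b g ≤ k)
    (hfin : ∀ b, ∀ ε : ℝ, 0 < ε → {g | g ∈ H b ∧ g ≠ 1 ∧ ε ≤ q b g}.Finite) {ε : ℝ} (hε : 0 < ε) :
    {x | ∃ b l, Word H b l ∧ ε ≤ wordSize q b l ∧ l.prod = x}.Finite := by
  obtain ⟨L, hL⟩ := exists_pow_lt_of_lt_one hε hk1
  set S : Set G := ⋃ b, {g | g ∈ H b ∧ g ≠ 1 ∧ ε ≤ q b g}
  have hS : S.Finite := Set.finite_iUnion fun b => hfin b ε hε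
  have : Finite S := hS
  refine ((List.finite_length_lt S L).image fun l => (l.map Subtype.val).prod).subset ?_
  -- A word of size at least `ε` has all its letters in the finite set `S` and has length less than
  -- `L`, since `k ^ L < ε`.
  rintro _ ⟨b, l, hl, hle, rfl⟩
  have hmem : ∀ g ∈ l, g ∈ S := fun g hg =>
    Set.mem_iUnion.2 (hl.le_of_le_wordSize hq (fun b g h h1 => (hqk b g h h1).trans hk1.le) hle g hg)
  have hlen : l.length < L := by
    by_contra! hlen
    have := (hle.trans (hl.wordSize_le hq hk hqk)).trans (pow_le_pow_of_le_one hk hk1.le hlen)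
    exact this.not_gt hL
  lift l to List S using hmem
  exact ⟨l, by simpa using hlen, rfl⟩

end Words

/-! ### The elements of the combination -/

section Combination

variable {n : ℕ} {r : ℝ} {M N : Matrix (Idx n) (Idx n) ℂ} {f g : PGLGroup n} {b : Bool}
  {H : Bool → Subgroup (PGLGroup n)} {size : Bool → PGLGroup n → ℝ}

@[simp] theorem domPart_smul (c : ℂ) (v : Idx n → ℂ) : domPart b (c • v) = c • domPart b v := by
  cases b <;> rfl

@[simp] theorem domPart_elim_self (x : Fin (n + 1) → ℂ) : domPart b (Sum.elim x x) = x := by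
  cases b <;> rfl

/-- The mapping properties of an alternating product that begins with a letter of type `b`. Here
`c` bounds the contraction. -/
structure IsLetterWord (r c : ℝ) (b : Bool) (N : Matrix (Idx n) (Idx n) ℂ) : Prop where
  maps : ∀ v, v ≠ 0 → (∀ b', r * vnorm (domPart b' v) ≤ vnorm (domPart (!b') v)) →
    vnorm (domPart (!b) (N.mulVec v)) < r * vnorm (domPart b (N.mulVec v))
  lower : ∀ x, (1 - r) * vnorm x ≤ c * vnorm (domPart b (N.mulVec (Sum.elim x x)))

theorem IsLetter.isLetterWord {c : ℝ} (h : IsLetter r c b M) (hr : r < 1) (hc : 0 ≤ c)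
    (hr0 : 0 < r) : IsLetterWord r (c / (1 - r ^ 2)) b M := by
  refine ⟨fun v hv hvb => h.maps v hv (hvb b), fun x => ?_⟩
  have h1 := h.lower (Sum.elim x x)
  rw [domPart_elim_self, domPart_elim_self] at h1
  have h2 : 0 < 1 - r ^ 2 := by nlinarith
  -- On the plane `z' = z''` the constant `c` would do; enlarging it gives all letters of a word the
  -- same form of factor.
  have h3 : c ≤ c / (1 - r ^ 2) := by
    rw [le_div_iff₀ h2]; nlinarith [mul_nonneg hc (sq_nonneg r)]
  have h4 := mul_le_mul_of_nonneg_right h3 (vnorm_nonneg (domPart b (M.mulVec (Sum.elim x x))))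
  linarith

/-- The word `N` leaves the part of type `!b` dominant, which is the region that a letter of type
`b` maps to its own side. There `‖domPart b‖ < r ‖domPart (!b)‖`, so the lower bound of the letter
improves to the factor `1 - r²`. -/
theorem IsLetterWord.mul {c d : ℝ} (hM : IsLetter r c b M) (hN : IsLetterWord r d (!b) N)
    (hNg : IsTauRep N g) (hr0 : 0 < r) (hr : r < 1) (hd : 0 ≤ d) :
    IsLetterWord r (c / (1 - r ^ 2) * d) b (M * N) := by
  have hr2 : 0 < 1 - r ^ 2 := by nlinarith
  have h0 : ∀ v, v ≠ 0 → (∀ b', r * vnorm (domPart b' v) ≤ vnorm (domPart (!b') v)) →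
      vnorm (domPart b (N.mulVec v)) < r * vnorm (domPart (!b) (N.mulVec v)) := by
    intro v hv hvb
    simpa using hN.maps v hv hvb
  constructor
  · intro v hv hvb
    rw [← Matrix.mulVec_mulVec]
    refine hM.maps _ (IsRep.mulVec_ne_zero hNg hv) ?_
    have h1 := h0 v hv hvb
    have h2 := vnorm_nonneg (domPart (!b) (N.mulVec v))
    nlinarith
  · intro x
    by_cases hx : x = 0
    · have : (Sum.elim x x : Idx n → ℂ) = 0 := by
        rw [hx]; ext (i | i) <;> rfl
      rw [this, hx, Matrix.mulVec_zero]
      cases b <;> simp [domPart]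
    rw [← Matrix.mulVec_mulVec]
    have hxx : (Sum.elim x x : Idx n → ℂ) ≠ 0 := fun h => hx (congrArg fstPart h)
    have h1 := h0 _ hxx (fun b' => by
      rw [domPart_elim_self, domPart_elim_self]
      nlinarith [vnorm_nonneg x])
    have h2 := hN.lower x
    have h3 := hM.lower (N.mulVec (Sum.elim x x))
    set w := N.mulVec (Sum.elim x x)
    have h4 : (1 - r ^ 2) * vnorm (domPart (!b) w) ≤ c * vnorm (domPart b (M.mulVec w)) := by
      nlinarith
    calc (1 - r) * vnorm x ≤ d * vnorm (domPart (!b) w) := h2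
      _ ≤ d * (c / (1 - r ^ 2) * vnorm (domPart b (M.mulVec w))) := by
        refine mul_le_mul_of_nonneg_left ?_ hd
        rw [div_mul_eq_mul_div, le_div_iff₀ hr2]
        linarith
      _ = _ := by ring

namespace IsLetterSystem

theorem exists_isLetterWord (hS : IsLetterSystem r H size) (hr0 : 0 < r) (hr : r < 1)
    {l : List (PGLGroup n)} (h : Word H b l) : ∃ N, IsTauRep N l.prod ∧
      IsLetterWord r (wordSize (fun b g => size b g / (1 - r ^ 2)) b l) b N := by
  have hr2 : 0 < 1 - r ^ 2 := by nlinarith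
  induction h with
  | @single b g hg hg1 =>
    obtain ⟨M, hM, hMl⟩ := hS.isLetter _ g hg hg1
    refine ⟨M, by simpa using hM, ?_⟩
    simpa [wordSize] using hMl.isLetterWord hr (hS.size_nonneg b g) hr0
  | @cons b g l hg hg1 hl ih =>
    obtain ⟨M, hM, hMl⟩ := hS.isLetter _ g hg hg1
    obtain ⟨N, hN, hNl⟩ := ih
    refine ⟨M * N, by simpa using hM.mul hN, IsLetterWord.mul hMl hNl hN hr0 hr ?_⟩
    exact wordSize_nonneg (fun b g => div_nonneg (hS.size_nonneg b g) hr2.le) _ _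

end IsLetterSystem

/-- The matrix of the dominant part on the plane `z' = z''`. -/
def domMat (b : Bool) (N : Matrix (Idx n) (Idx n) ℂ) : Blk n :=
  cond b (N.toBlocks₂₁ + N.toBlocks₂₂) (N.toBlocks₁₁ + N.toBlocks₁₂)

theorem domPart_mulVec_elim_self (N : Matrix (Idx n) (Idx n) ℂ) (x : Fin (n + 1) → ℂ) :
    domPart b (N.mulVec (Sum.elim x x)) = (domMat b N).mulVec x := by
  cases b
  · simp [domPart, domMat, fstPart_mulVec, Matrix.add_mulVec]
  · simp [domPart, domMat, sndPart_mulVec, Matrix.add_mulVec]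

namespace IsLetterWord

variable {c : ℝ}

theorem domMat_lt (h : IsLetterWord r c b N) (hr : r < 1) {x : Fin (n + 1) → ℂ} (hx : x ≠ 0) :
    vnorm ((domMat (!b) N).mulVec x) < r * vnorm ((domMat b N).mulVec x) := by
  rw [← domPart_mulVec_elim_self, ← domPart_mulVec_elim_self]
  refine h.maps _ (fun h => hx (congrArg fstPart h)) fun b' => ?_
  rw [domPart_elim_self, domPart_elim_self]
  nlinarith [vnorm_nonneg x]

theorem det_domMat_ne_zero (h : IsLetterWord r c b N) (hr : r < 1) : (domMat b N).det ≠ 0 := by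
  refine det_ne_zero_of_vnorm fun x hx h0 => ?_
  have := h.domMat_lt hr hx
  rw [h0, vnorm_zero, mul_zero] at this
  exact this.not_ge (vnorm_nonneg _)

theorem vnorm_tauConj_mulVec (N : Matrix (Idx n) (Idx n) ℂ) (x : Fin (n + 1) → ℂ) :
    vnorm ((tauConj N).toBlocks₂₁.mulVec x) =
      2⁻¹ * vnorm ((domMat b N).mulVec x - (domMat (!b) N).mulVec x) := by
  rw [tauConj_toBlocks₂₁, Matrix.smul_mulVec, vnorm_smul, Matrix.sub_mulVec, norm_inv,
    Complex.norm_ofNat]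
  cases b
  · rw [← vnorm_neg, neg_sub]; rfl
  · rfl

/-- The block `C` in the coordinates `w` is half the difference of the two parts on the plane `z' =
z''`, up to sign. One factor `1 - r` comes from the dominance of one part over the other, the second
from `lower`, and the `2` from `τ⁻¹`. -/
theorem vnorm_le (h : IsLetterWord r c b N) (hr : r < 1) (hc : 0 ≤ c)
    (x : Fin (n + 1) → ℂ) :
    vnorm x ≤ 2 / (1 - r) ^ 2 * c * vnorm ((tauConj N).toBlocks₂₁.mulVec x) := by
  by_cases hx : x = 0
  · simp [hx]
  rw [vnorm_tauConj_mulVec (b := b)]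
  have h1 := h.domMat_lt hr hx
  have h2 := h.lower x
  rw [domPart_mulVec_elim_self] at h2
  have h3 := vnorm_sub_vnorm_le ((domMat b N).mulVec x) (-(domMat (!b) N).mulVec x)
  rw [vnorm_neg, ← sub_eq_add_neg] at h3
  set D := vnorm ((domMat b N).mulVec x - (domMat (!b) N).mulVec x)
  have h4 : (1 - r) * vnorm ((domMat b N).mulVec x) ≤ D := by linarith
  have h5 : 0 < 1 - r := by linarith
  have h6 : (1 - r) ^ 2 * vnorm x ≤ c * D := by
    nlinarith [mul_le_mul_of_nonneg_left h2 h5.le, mul_le_mul_of_nonneg_left h4 hc]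
  rw [show 2 / (1 - r) ^ 2 * c * (2⁻¹ * D) = (c * D) / (1 - r) ^ 2 by ring,
    le_div_iff₀ (by positivity)]
  linarith

theorem det_ne_zero (h : IsLetterWord r c b N) (hr : r < 1) (hc : 0 ≤ c) :
    (tauConj N).toBlocks₂₁.det ≠ 0 := by
  refine det_ne_zero_of_vnorm fun x hx h0 => ?_
  have := h.vnorm_le hr hc x
  rw [h0, vnorm_zero, mul_zero] at this
  exact this.not_gt (vnorm_pos hx)

theorem opNorm_inv_le (h : IsLetterWord r c b N) (hr : r < 1) (hc : 0 ≤ c) :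
    opNorm (tauConj N).toBlocks₂₁⁻¹ ≤ 2 / (1 - r) ^ 2 * c :=
  TypeLGroup.opNorm_inv_le (mul_nonneg (div_nonneg zero_le_two (sq_nonneg _)) hc)
    (h.det_ne_zero hr hc) (h.vnorm_le hr hc)

/-- The image of the plane `w'' = 0`, as the Cayley transform of a contraction. -/
theorem exists_cayley (h : IsLetterWord r c b N) (hr0 : 0 < r) (hr : r < 1) :
    ∃ X : Blk n, opNorm X ≤ r ∧ (tauConj N).toBlocks₁₁ * (tauConj N).toBlocks₂₁⁻¹ =
      (cond b 1 (-1) : ℂ) • ((1 + X) * (1 - X)⁻¹) := by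
  have hD := h.det_domMat_ne_zero hr
  have hDu := isUnit_iff_ne_zero.2 hD
  -- The image of `z' = z''` is the graph of this matrix over the dominant part. Applying `τ` to the
  -- graph yields `1 + X` above and `±(1 - X)` below; the sign records which part dominates.
  refine ⟨domMat (!b) N * (domMat b N)⁻¹, opNorm_le hr0.le fun u => ?_, ?_⟩
  · by_cases hu : u = 0
    · simp [hu]
    rw [← Matrix.mulVec_mulVec]
    have hx : (domMat b N)⁻¹.mulVec u ≠ 0 := fun h0 =>
      hu (by rw [← mulVec_inv_cancel hD u, h0, Matrix.mulVec_zero])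
    have := (h.domMat_lt hr hx).le
    rwa [mulVec_inv_cancel hD] at this
  · set X := domMat (!b) N * (domMat b N)⁻¹ with hX
    have hXD : X * domMat b N = domMat (!b) N := by
      rw [hX, Matrix.mul_assoc, Matrix.nonsing_inv_mul _ hDu, Matrix.mul_one]
    have h1 : (tauConj N).toBlocks₁₁ = (2 : ℂ)⁻¹ • ((1 + X) * domMat b N) := by
      rw [tauConj_toBlocks₁₁, Matrix.add_mul, hXD, Matrix.one_mul]
      cases b
      · rfl
      · exact congrArg _ (add_comm _ _)
    have h2 : (tauConj N).toBlocks₂₁ =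
        ((cond b 1 (-1) : ℂ) * (2 : ℂ)⁻¹) • ((1 - X) * domMat b N) := by
      rw [tauConj_toBlocks₂₁, Matrix.sub_mul, hXD, Matrix.one_mul]
      cases b
      · simp only [domMat, cond_false, Bool.not_false, cond_true]; module
      · simp only [domMat, cond_false, Bool.not_true, cond_true]; module
    have hk : (cond b 1 (-1) * (2 : ℂ)⁻¹) ≠ 0 := by cases b <;> simp
    rw [h1, h2, inv_smul_matrix hk, Matrix.mul_inv_rev, smul_mul_smul_comm]
    rw [Matrix.mul_assoc, ← Matrix.mul_assoc (domMat b N), Matrix.mul_nonsing_inv _ hDu,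
      Matrix.one_mul]
    congr 1
    cases b <;> simp

end IsLetterWord

end Combination

/-! ### Ping-pong in the new coordinates and the growth of the words -/

section CombinationResults

variable {n : ℕ} {r : ℝ} {M N : Matrix (Idx n) (Idx n) ℂ} {f g : PGLGroup n} {b : Bool}
  {H : Bool → Subgroup (PGLGroup n)} {size : Bool → PGLGroup n → ℝ}

theorem isRep_one : IsRep (1 : Matrix (Idx n) (Idx n) ℂ) 1 :=
  ⟨Matrix.det_one, 1, rfl, map_one _⟩

theorem ne_one_of_det_blockC_ne_zero (h : (blockC g).det ≠ 0) : g ≠ 1 := by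
  rintro rfl
  rw [isRep_one.det_blockC_ne_zero_iff, ← Matrix.fromBlocks_one, Matrix.toBlocks_fromBlocks₂₁] at h
  exact h Matrix.det_zero

/-- The radius makes `V_R` lie in the region where both ratios of `‖z'‖` and `‖z''‖` are at least
`r`. Conversely, if one of `z'`, `z''` is less than `r` times the other in norm, then `‖z' + z''‖ ≤
R‖z'' - z'‖`, so the image is outside `V_R`. -/
theorem IsLetterWord.movesTube {c : ℝ} (h : IsLetterWord r c b N) (hr0 : 0 < r) (hr : r < 1) :
    MovesTube ((1 + r) / (1 - r)) (tauConj N) := by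
  have hr1 : 0 < 1 - r := by linarith
  intro v hv
  rw [div_mul_eq_mul_div, div_lt_iff₀ hr1] at hv
  set z : Idx n → ℂ := Sum.elim ((2 : ℂ)⁻¹ • (fstPart v - sndPart v))
    ((2 : ℂ)⁻¹ • (fstPart v + sndPart v)) with hz
  have hzv : ((2 : ℂ)⁻¹ • Matrix.fromBlocks (1 : Blk n) (-1) 1 1).mulVec v = z := by
    ext (i | i) <;> simp [hz, Matrix.smul_mulVec, Matrix.fromBlocks_mulVec, Function.comp_def,
      Matrix.neg_mulVec, sub_eq_add_neg, fstPart, sndPart, mul_add]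
  have hF : ∀ y : Idx n → ℂ, (Matrix.fromBlocks (1 : Blk n) 1 (-1) 1).mulVec y =
      Sum.elim (fstPart y + sndPart y) (sndPart y - fstPart y) := by
    intro y
    ext (i | i) <;> simp [Matrix.fromBlocks_mulVec, Function.comp_def, Matrix.neg_mulVec,
      sub_eq_neg_add, fstPart, sndPart]
  have hz1 : vnorm (fstPart z) = 2⁻¹ * vnorm (fstPart v - sndPart v) := by
    rw [hz, fstPart_elim, vnorm_smul, norm_inv, Complex.norm_ofNat]
  have hz2 : vnorm (sndPart z) = 2⁻¹ * vnorm (fstPart v + sndPart v) := by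
    rw [hz, sndPart_elim, vnorm_smul, norm_inv, Complex.norm_ofNat]
  have e1 := vnorm_sub_le (fstPart v) (sndPart v)
  have e2 := vnorm_add_le (fstPart v) (sndPart v)
  have e3 := vnorm_sub_vnorm_le (fstPart v) (sndPart v)
  have e4 := vnorm_sub_vnorm_le (fstPart v) (-sndPart v)
  rw [vnorm_neg, ← sub_eq_add_neg] at e4
  have e5 := vnorm_nonneg (sndPart v)
  have hz0 : z ≠ 0 := by
    intro h0
    rw [h0, fstPart_zero, vnorm_zero] at hz1
    nlinarith
  have hmaps := h.maps z hz0 (by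
    rintro (_ | _) <;> simp only [domPart, cond_true, cond_false, Bool.not_true, Bool.not_false,
      hz1, hz2] <;> nlinarith)
  rw [tauConj, ← Matrix.mulVec_mulVec, ← Matrix.mulVec_mulVec, hzv, hF, fstPart_elim, sndPart_elim]
  set y := N.mulVec z
  rw [div_mul_eq_mul_div, le_div_iff₀ hr1]
  have key : ∀ p q : Fin (n + 1) → ℂ, vnorm q < r * vnorm p →
      vnorm (p + q) * (1 - r) ≤ (1 + r) * vnorm (p - q) := by
    intro p q hpq
    have h1 := vnorm_add_le p q
    have h2 := vnorm_sub_vnorm_le p (-q)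
    rw [vnorm_neg, ← sub_eq_add_neg] at h2
    nlinarith [vnorm_nonneg p]
  cases b
  · have := key (fstPart y) (sndPart y) hmaps
    rwa [← vnorm_neg (fstPart y - sndPart y), neg_sub] at this
  · have := key (sndPart y) (fstPart y) hmaps
    rwa [add_comm (sndPart y)] at this

namespace IsLetterSystem

theorem ratio_nonneg (hS : IsLetterSystem r H size) (hr0 : 0 < r) (hr : r < 1) (b : Bool)
    (g : PGLGroup n) : 0 ≤ size b g / (1 - r ^ 2) :=
  div_nonneg (hS.size_nonneg b g) (by nlinarith)

theorem det_ne_zero (hS : IsLetterSystem r H size) (hr0 : 0 < r) (hr : r < 1)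
    {l : List (PGLGroup n)} (h : Word H b l) : (blockC l.prod).det ≠ 0 := by
  obtain ⟨N, hN, hNl⟩ := hS.exists_isLetterWord hr0 hr h
  rw [hN.isRep.det_blockC_ne_zero_iff]
  exact hNl.det_ne_zero hr (wordSize_nonneg (hS.ratio_nonneg hr0 hr) _ _)

/-- A common element other than `1` would map the point with all coordinates `1` to a point at which
each part is strictly dominated by the other. -/
theorem eq_one_of_mem (hS : IsLetterSystem r H size) (hr : r < 1) (g : PGLGroup n)
    (h₁ : g ∈ H true) (h₂ : g ∈ H false) : g = 1 := by
  by_contra hg1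
  obtain ⟨M, hM, hMl⟩ := hS.isLetter _ g h₁ hg1
  obtain ⟨N, hN, hNl⟩ := hS.isLetter _ g h₂ hg1
  obtain ⟨ζ, hζ, rfl⟩ := IsRep.exists_unit_smul hM hN
  have hx : (Sum.elim 1 1 : Idx n → ℂ) ≠ 0 := fun h => one_ne_zero (congrArg fstPart h)
  have hb : ∀ b, r * vnorm (domPart b (Sum.elim 1 1 : Idx n → ℂ)) ≤
      vnorm (domPart (!b) (Sum.elim 1 1 : Idx n → ℂ)) := fun b => by
    rw [domPart_elim_self, domPart_elim_self]
    nlinarith [vnorm_nonneg (1 : Fin (n + 1) → ℂ)]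
  have h1 := hMl.maps _ hx (hb true)
  have h2 := hNl.maps _ hx (hb false)
  rw [Matrix.smul_mulVec, domPart_smul, domPart_smul, vnorm_smul, vnorm_smul, hζ, one_mul,
    one_mul] at h2
  simp only [Bool.not_true, Bool.not_false] at h1 h2
  nlinarith [vnorm_nonneg (domPart true (M.mulVec (Sum.elim 1 1))),
    vnorm_nonneg (domPart false (M.mulVec (Sum.elim 1 1)))]

/-- This is the inductive step of the norm estimate: `C_{gh} = C_g · (± Z) · C_h`, where `Z` is a
sum of Cayley transforms of two matrices of norm at most `r`, and `‖Z⁻¹‖ ≤ K_r`. -/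
theorem radius_mul_le (hS : IsLetterSystem r H size) (hr0 : 0 < r) (hr : r < 1)
    {l : List (PGLGroup n)} (hg : g ∈ H b) (hg1 : g ≠ 1) (h : Word H (!b) l) :
    radius (g * l.prod) ≤ combConst n r * (radius g * radius l.prod) := by
  obtain ⟨N, hN, hNl⟩ := hS.exists_isLetterWord hr0 hr h
  -- The inverse `g⁻¹` is a word of the same type as `g`; it supplies the Cayley transform for
  -- `C_g⁻¹ D_g`.
  obtain ⟨N', hN', hNl'⟩ := hS.exists_isLetterWord hr0 hr
    (Word.single (inv_mem hg) (inv_ne_one.2 hg1))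
  rw [List.prod_singleton] at hN'
  obtain ⟨X, hX, hXe⟩ := hNl.exists_cayley hr0 hr
  obtain ⟨Y, hY, hYe⟩ := hNl'.exists_cayley hr0 hr
  have hP := hN.isRep
  have hP' := hN'.isRep
  have hq := hS.ratio_nonneg hr0 hr
  have hC := hNl.det_ne_zero hr (wordSize_nonneg hq _ _)
  have hC' := hNl'.det_ne_zero hr (wordSize_nonneg hq _ _)
  generalize tauConj N = P at *
  generalize tauConj N' = P' at *
  have hQ := hP'.inv
  rw [inv_inv] at hQ
  have hQP : P'⁻¹ * P' = 1 := Matrix.nonsing_inv_mul _ hP'.isUnit_det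
  have h21 : P'⁻¹.toBlocks₂₁ * P'.toBlocks₁₁ + P'⁻¹.toBlocks₂₂ * P'.toBlocks₂₁ = 0 := by
    rw [← mul_toBlocks₂₁, hQP, ← Matrix.fromBlocks_one, Matrix.toBlocks_fromBlocks₂₁]
  have hCu := isUnit_iff_ne_zero.2 hC
  have hCu' := isUnit_iff_ne_zero.2 hC'
  have hD : P'⁻¹.toBlocks₂₂ = -(P'⁻¹.toBlocks₂₁ * (P'.toBlocks₁₁ * P'.toBlocks₂₁⁻¹)) := by
    rw [← Matrix.mul_assoc, ← Matrix.neg_mul, ← eq_neg_of_add_eq_zero_right h21, Matrix.mul_assoc,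
      Matrix.mul_nonsing_inv _ hCu', Matrix.mul_one]
  set Z := (1 + X) * (1 - X)⁻¹ + (1 + Y) * (1 - Y)⁻¹ with hZ
  have hA : P.toBlocks₁₁ = (P.toBlocks₁₁ * P.toBlocks₂₁⁻¹) * P.toBlocks₂₁ := by
    rw [Matrix.mul_assoc, Matrix.nonsing_inv_mul _ hCu, Matrix.mul_one]
  -- The two terms have the same sign because the types `b` and `!b` are opposite and `hD` brings in
  -- another minus sign.
  have hprod : (P'⁻¹ * P).toBlocks₂₁ =
      P'⁻¹.toBlocks₂₁ * ((cond b (-1) 1 : ℂ) • Z) * P.toBlocks₂₁ := by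
    rw [mul_toBlocks₂₁, hA, hD, hXe, hYe, ← Matrix.mul_assoc, ← Matrix.add_mul,
      ← Matrix.mul_neg, ← Matrix.mul_add]
    congr 2
    cases b <;> simp [hZ, add_comm]
  have hk : (cond b (-1) 1 : ℂ) ≠ 0 := by cases b <;> simp
  have hk1 : ‖(cond b (-1) 1 : ℂ)⁻¹‖ = 1 := by cases b <;> simp
  rw [(hQ.mul hP).radius_eq, hQ.radius_eq, hP.radius_eq, hprod, Matrix.mul_inv_rev,
    Matrix.mul_inv_rev, inv_smul_matrix hk]
  have h0 := opNorm_cayley_add_inv_le hX hY hr0.le hr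
  calc _ ≤ opNorm P.toBlocks₂₁⁻¹ *
        opNorm ((cond b (-1) 1 : ℂ)⁻¹ • Z⁻¹ * P'⁻¹.toBlocks₂₁⁻¹) := opNorm_mul_le _ _
    _ ≤ opNorm P.toBlocks₂₁⁻¹ * (combConst n r * opNorm P'⁻¹.toBlocks₂₁⁻¹) := by
      refine mul_le_mul_of_nonneg_left ((opNorm_mul_le _ _).trans ?_) (opNorm_nonneg _)
      rw [opNorm_smul, hk1, one_mul]
      exact mul_le_mul_of_nonneg_right h0 (opNorm_nonneg _)
    _ = _ := by ring

theorem radius_prod_le (hS : IsLetterSystem r H size) (hr0 : 0 < r) (hr : r < 1)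
    {l : List (PGLGroup n)} (h : Word H b l) :
    radius l.prod ≤ combConst n r ^ (l.length - 1) * (l.map radius).prod := by
  induction h with
  | single => simp
  | @cons b g l hg hg1 hl ih =>
    -- A word is not empty, so the truncated subtraction is harmless.
    have hlen : l.length = (l.length - 1) + 1 := by
      cases hl <;> simp
    have hK := combConst_nonneg (n := n) hr0.le hr
    rw [List.prod_cons, List.length_cons, Nat.add_sub_cancel, List.map_cons, List.prod_cons, hlen,
      pow_succ']
    calc radius (g * l.prod) ≤ combConst n r * (radius g * radius l.prod) :=
          hS.radius_mul_le hr0 hr hg hg1 hl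
      _ ≤ combConst n r * (radius g *
          (combConst n r ^ (l.length - 1) * (l.map radius).prod)) :=
        mul_le_mul_of_nonneg_left (mul_le_mul_of_nonneg_left ih (opNorm_nonneg _)) hK
      _ = _ := by ring

/-- This estimate, and not the one with `K_r`, yields (♣) and (♠): the sizes in the coordinates `z`
are known to be at most `r`, whereas the radii of the letters in the coordinates `w` need not be
small. -/
theorem radius_le_wordSize (hS : IsLetterSystem r H size) (hr0 : 0 < r) (hr : r < 1)
    {l : List (PGLGroup n)} (h : Word H b l) : radius l.prod ≤
      2 / (1 - r) ^ 2 * wordSize (fun b g => size b g / (1 - r ^ 2)) b l := by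
  obtain ⟨N, hN, hNl⟩ := hS.exists_isLetterWord hr0 hr h
  rw [hN.isRep.radius_eq]
  exact hNl.opNorm_inv_le hr (wordSize_nonneg (hS.ratio_nonneg hr0 hr) _ _)

theorem movesTube (hS : IsLetterSystem r H size) (hr0 : 0 < r) (hr : r < 1)
    (hf : f ∈ H true ⊔ H false) (hf1 : f ≠ 1) (hM : IsRep M f) :
    MovesTube ((1 + r) / (1 - r)) M := by
  obtain ⟨b, l, hl, rfl⟩ := (eq_one_or_exists_word hf).resolve_left hf1
  obtain ⟨N, hN, hNl⟩ := hS.exists_isLetterWord hr0 hr hl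
  exact hM.disjoint_tube_iff.1 (hN.isRep.disjoint_tube_iff.2 (hNl.movesTube hr0 hr))

theorem ratio_le (hS : IsLetterSystem r H size) (hr0 : 0 < r) (hr : r < 1) :
    ∀ b, ∀ g ∈ H b, g ≠ 1 → size b g / (1 - r ^ 2) ≤ r / (1 - r ^ 2) := fun b g hg hg1 =>
  div_le_div_of_nonneg_right (hS.size_le b g hg hg1) (by nlinarith)

theorem club (hS : IsLetterSystem r H size) (hr0 : 0 < r) (hr : r < 1) (hrr : r < 1 - r ^ 2) :
    Club (H true ⊔ H false) := by
  refine ⟨2 / (1 - r) ^ 2, fun f hf hf1 => ?_⟩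
  obtain ⟨b, l, hl, rfl⟩ := (eq_one_or_exists_word hf).resolve_left hf1
  refine (hS.radius_le_wordSize hr0 hr hl).trans (mul_le_of_le_one_right (by positivity) ?_)
  have := hl.wordSize_le (hS.ratio_nonneg hr0 hr) zero_le_one fun b g hg hg1 =>
    (hS.ratio_le hr0 hr b g hg hg1).trans ((div_lt_one (by nlinarith)).2 hrr).le
  simpa using this

theorem finite_le_radius (hS : IsLetterSystem r H size) (hr0 : 0 < r) (hr : r < 1)
    (hrr : r < 1 - r ^ 2) {ε : ℝ} (hε : 0 < ε) :
    {f | f ∈ H true ⊔ H false ∧ f ≠ 1 ∧ ε ≤ radius f}.Finite := by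
  have hr2 : 0 < 1 - r ^ 2 := by linarith
  have hr1 : 0 < 1 - r := by linarith
  -- The threshold is `ε` divided by the constant `2/(1 - r)²` of `radius_le_wordSize`.
  refine (finite_prod_of_le_wordSize (H := H) (q := fun b g => size b g / (1 - r ^ 2))
    (hS.ratio_nonneg hr0 hr) (k := r / (1 - r ^ 2)) (by positivity) ((div_lt_one hr2).2 hrr)
    (hS.ratio_le hr0 hr) (fun b δ hδ => ?_) (ε := ε * (1 - r) ^ 2 / 2) (by positivity)).subset ?_
  · refine (hS.finite b (δ * (1 - r ^ 2)) (by positivity)).subset ?_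
    rintro g ⟨hg, hg1, hle⟩
    exact ⟨hg, hg1, (le_div_iff₀ hr2).1 hle⟩
  · rintro f ⟨hf, hf1, hle⟩
    obtain ⟨b, l, hl, rfl⟩ := (eq_one_or_exists_word hf).resolve_left hf1
    refine ⟨b, l, hl, ?_, rfl⟩
    have := hle.trans (hS.radius_le_wordSize hr0 hr hl)
    rw [div_mul_eq_mul_div, le_div_iff₀ (by positivity)] at this
    linarith

end IsLetterSystem

/-- The converse of `Spade.finite_le_radius`. -/
theorem spade_of_finite {Γ : Subgroup (PGLGroup n)}
    (h : ∀ ε : ℝ, 0 < ε → {g | g ∈ Γ ∧ g ≠ 1 ∧ ε ≤ radius g}.Finite) : Spade Γ := by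
  intro x hx
  rcases lt_or_gt_of_ne hx with hx | hx
  · refine ⟨-x, by linarith, Set.Finite.subset Set.finite_empty ?_⟩
    rintro g ⟨-, -, hg⟩
    have := (abs_lt.1 hg).2
    have h0 : 0 ≤ radius g := opNorm_nonneg _
    linarith
  · refine ⟨x / 2, by linarith, (h (x / 2) (by linarith)).subset ?_⟩
    rintro g ⟨hg, hg1, hgx⟩
    exact ⟨hg, hg1, by linarith [(abs_lt.1 hgx).1]⟩

end CombinationResults

/-! ### Discreteness and large domains -/

section Discrete

variable {n : ℕ} {R : ℝ} {Γ : Subgroup (PGLGroup n)}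

/-- A group whose elements other than `1` move a tube off itself is discrete. -/
theorem discreteTopology_of_disjoint
    (h : ∀ g ∈ Γ, g ≠ 1 → Disjoint ((fun p : PSpace n => g • p) '' tube R) (tube R)) :
    DiscreteTopology Γ := by
  have he : (Sum.elim 1 0 : Idx n → ℂ) ≠ 0 := fun h => one_ne_zero (congrArg fstPart h)
  have hp : (Projectivization.mk ℂ _ he : PSpace n) ∈ tube R := by
    rw [mk_mem_tube_iff]
    simpa using vnorm_pos (one_ne_zero : (1 : Fin (n + 1) → ℂ) ≠ 0)
  rw [discreteTopology_iff_isOpen_singleton]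
  rintro ⟨g, hg⟩
  obtain ⟨w, hw⟩ := Matrix.ProjGenLinGroup.mk_surjective g⁻¹
  -- This open set contains `g`, and no other element of `Γ`, since `g⁻¹k ≠ 1` moves the chosen
  -- point out of the tube.
  have hO : IsOpen {k : PGLGroup n | (g⁻¹ * k) • (Projectivization.mk ℂ _ he : PSpace n) ∈
      tube R} := by
    refine isOpen_coinduced.2 ?_
    have : Matrix.ProjGenLinGroup.mk ⁻¹' {k : PGLGroup n |
        (g⁻¹ * k) • (Projectivization.mk ℂ _ he : PSpace n) ∈ tube R} =
        {u : Matrix.GeneralLinearGroup (Idx n) ℂ |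
          R * vnorm (sndPart (((w : Matrix (Idx n) (Idx n) ℂ) * u).mulVec (Sum.elim 1 0))) <
            vnorm (fstPart (((w : Matrix (Idx n) (Idx n) ℂ) * u).mulVec (Sum.elim 1 0)))} := by
      ext u
      change (g⁻¹ * Matrix.ProjGenLinGroup.mk u) • _ ∈ tube R ↔ _
      rw [← hw, ← map_mul, Projectivization.PGL.mk_smul_mk, mk_mem_tube_iff]
      rfl
    rw [this]
    have hc : Continuous fun u : Matrix.GeneralLinearGroup (Idx n) ℂ =>
        ((w : Matrix (Idx n) (Idx n) ℂ) * u).mulVec (Sum.elim 1 0 : Idx n → ℂ) :=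
      (continuous_const.matrix_mul Units.continuous_val).matrix_mulVec continuous_const
    exact isOpen_lt (by fun_prop) (by fun_prop)
  convert hO.preimage (continuous_subtype_val (p := fun x => x ∈ Γ))
  ext ⟨k, hk⟩
  simp only [Set.mem_singleton_iff, Subtype.mk.injEq, Set.mem_preimage, Set.mem_ofPred_eq]
  constructor
  · rintro rfl
    rwa [inv_mul_cancel, one_smul]
  · intro hmem
    by_contra hne
    have hne' : g⁻¹ * k ≠ 1 := fun h1 => hne (inv_mul_eq_one.1 h1).symm
    exact Set.disjoint_left.1 (h _ (mul_mem (inv_mem hg) hk) hne') ⟨_, hp, rfl⟩ hmem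

/-- The cone is the image of the product of `ℂ^{n+1} ∖ {0}` and the ball of radius `1/R` under `(x,
y) ↦ (x, ‖x‖y)`. The first factor is connected because its real dimension exceeds `1`. -/
theorem isConnected_cone (n : ℕ) (hR : 0 < R) :
    IsConnected {v : Idx n → ℂ | R * vnorm (sndPart v) < vnorm (fstPart v)} := by
  have hrank : 1 < Module.rank ℝ (EuclideanSpace ℂ (Fin (n + 1))) := by
    have h : Module.finrank ℝ (EuclideanSpace ℂ (Fin (n + 1))) = 2 * (n + 1) := by
      rw [finrank_real_of_complex, finrank_euclideanSpace, Fintype.card_fin]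
    have := Module.lt_rank_of_lt_finrank (R := ℝ) (M := EuclideanSpace ℂ (Fin (n + 1))) (n := 1)
      (by omega)
    exact_mod_cast this
  have h1 := isConnected_compl_singleton_of_one_lt_rank hrank 0
  have h2 : IsConnected (Metric.ball (0 : EuclideanSpace ℂ (Fin (n + 1))) R⁻¹) :=
    (convex_ball _ _).isConnected ⟨0, Metric.mem_ball_self (by positivity)⟩
  have h3 := (h1.prod h2).image (fun q => (Sum.elim q.1.ofLp (((‖q.1‖ : ℝ) : ℂ) • q.2.ofLp) :
    Idx n → ℂ)) (by
      refine Continuous.continuousOn (continuous_pi fun i => ?_)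
      rcases i with i | i <;> simp only [Sum.elim_inl, Sum.elim_inr, Pi.smul_apply] <;> fun_prop)
  convert h3 using 1
  ext v
  constructor
  · intro hv
    have hv0 : 0 < vnorm (fstPart v) :=
      (mul_nonneg hR.le (vnorm_nonneg _)).trans_lt hv
    refine ⟨(WithLp.toLp 2 (fstPart v),
      WithLp.toLp 2 (((vnorm (fstPart v) : ℝ) : ℂ)⁻¹ • sndPart v)), ⟨?_, ?_⟩, ?_⟩
    · intro h0
      have : vnorm (fstPart v) = 0 := by
        unfold vnorm
        rw [show WithLp.toLp 2 (fstPart v) = (0 : EuclideanSpace ℂ (Fin (n + 1))) from h0, norm_zero]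
      exact hv0.ne' this
    · rw [Metric.mem_ball, dist_zero_right]
      change vnorm _ < _
      rw [vnorm_smul, norm_inv, Complex.norm_real, Real.norm_of_nonneg hv0.le,
        inv_mul_lt_iff₀ hv0, ← div_eq_mul_inv, lt_div_iff₀ hR, mul_comm]
      exact hv
    · have : ((vnorm (fstPart v) : ℝ) : ℂ) ≠ 0 := Complex.ofReal_ne_zero.2 hv0.ne'
      change Sum.elim (fstPart v) (((vnorm (fstPart v) : ℝ) : ℂ) •
        ((vnorm (fstPart v) : ℝ) : ℂ)⁻¹ • sndPart v) = v
      rw [smul_inv_smul₀ this, elim_parts]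
  · rintro ⟨⟨x, y⟩, ⟨hx, hy⟩, rfl⟩
    change R * vnorm (((‖x‖ : ℝ) : ℂ) • y.ofLp) < ‖x‖
    rw [vnorm_smul, Complex.norm_real, norm_norm]
    rw [Metric.mem_ball, dist_zero_right, ← one_div, lt_div_iff₀ hR] at hy
    change R * (‖x‖ * ‖y‖) < ‖x‖
    have hx0 : 0 < ‖x‖ := norm_pos_iff.2 hx
    nlinarith

theorem isLargeDomain_tube (n : ℕ) (hR : 0 < R) : IsLargeDomain (tube R : Set (PSpace n)) := by
  refine ⟨isOpen_tube R, ?_, ?_⟩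
  · set C := {v : Idx n → ℂ | R * vnorm (sndPart v) < vnorm (fstPart v)}
    set C' : Set {v : Idx n → ℂ // v ≠ 0} := Subtype.val ⁻¹' C
    have hCC : Subtype.val '' C' = C := by
      refine (Subtype.image_preimage_coe _ _).trans (Set.inter_eq_right.2 ?_)
      rintro v hv rfl
      have hv : R * vnorm (sndPart (0 : Idx n → ℂ)) < vnorm (fstPart (0 : Idx n → ℂ)) := hv
      simp at hv
    have hC : IsConnected C := isConnected_cone n hR
    have hC' : IsConnected C' := by
      rw [← hCC] at hC
      exact ⟨hC.1.of_image, (Topology.IsInducing.subtypeVal.isPreconnected_image).1 hC.2⟩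
    convert hC'.image _ continuous_mk'.continuousOn
    ext p
    constructor
    · intro hp
      induction p using Projectivization.ind with | h v hv =>
      exact ⟨⟨v, hv⟩, (mk_mem_tube_iff hv).1 hp, rfl⟩
    · rintro ⟨⟨v, hv⟩, hvC, rfl⟩
      exact (mk_mem_tube_iff hv).2 hvC
  · let φ : (Fin (n + 1) → ℂ) →ₗ[ℂ] (Idx n → ℂ) :=
      { toFun := fun x => Sum.elim x 0
        map_add' := fun x y => by ext (i | i) <;> simp
        map_smul' := fun c x => by ext (i | i) <;> simp }
    have hφ : Function.Injective φ := fun x y h => congrArg (fstPart (n := n)) h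
    refine ⟨LinearMap.range φ, ?_, ?_⟩
    · rw [LinearMap.finrank_range_of_inj hφ]
      simp
    · intro p hp
      induction p using Projectivization.ind with | h v hv =>
      have hp : (Projectivization.mk ℂ v hv).submodule ≤ LinearMap.range φ := hp
      rw [Projectivization.submodule_mk, Submodule.span_singleton_le_iff_mem] at hp
      obtain ⟨x, rfl⟩ := hp
      rw [mk_mem_tube_iff]
      have hx : x ≠ 0 := by
        rintro rfl
        exact hv (map_zero φ)
      change R * vnorm (0 : Fin (n + 1) → ℂ) < vnorm x
      simpa using vnorm_pos hx

end Discrete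

/-! ### Minors and Plücker coordinates -/

section Minors

variable {n : ℕ}

/-- The matrix of the graph `z' = X z''`. -/
def graphMat (X : Blk n) : Matrix (Idx n) (Fin (n + 1)) ℂ := Matrix.fromRows X 1

/-- A bordered minor, see `det_submatrix_eq`. -/
def borderedMinor (P X Y E : Blk n) (K J : Fin (n + 1) → Idx n) : ℂ :=
  (Matrix.fromBlocks P ((Matrix.fromCols 1 Y).submatrix id J) ((graphMat X).submatrix K id)
    ((Matrix.fromBlocks 0 E 0 0).submatrix K J)).det

/-- The minors of `M` in terms of quantities that stay bounded when `C⁻¹` tends to `0`. -/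
theorem det_submatrix_eq {M : Matrix (Idx n) (Idx n) ℂ} (hC : M.toBlocks₂₁.det ≠ 0)
    (K J : Fin (n + 1) → Idx n) : (M.submatrix K J).det =
      (-1) ^ (n + 1) * M.toBlocks₂₁.det * borderedMinor M.toBlocks₂₁⁻¹
        (M.toBlocks₁₁ * M.toBlocks₂₁⁻¹) (M.toBlocks₂₁⁻¹ * M.toBlocks₂₂)
        (M.toBlocks₁₁ * M.toBlocks₂₁⁻¹ * M.toBlocks₂₂ - M.toBlocks₁₂) K J := by
  have hCu := isUnit_iff_ne_zero.2 hC
  set A := M.toBlocks₁₁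
  set B := M.toBlocks₁₂
  set C := M.toBlocks₂₁
  set D := M.toBlocks₂₂
  have hM : M = Matrix.fromBlocks A B C D := M.fromBlocks_toBlocks.symm
  let _ : Invertible C := Matrix.invertibleOfIsUnitDet C hCu
  -- The matrix `-M` is the Schur complement of the block `C⁻¹` in the bordered matrix, and passing
  -- to the rows `K` and columns `J` commutes with this.
  have key : Matrix.fromBlocks 0 (A * C⁻¹ * D - B) 0 0 -
      graphMat (A * C⁻¹) * C * Matrix.fromCols 1 (C⁻¹ * D) = -M := by
    rw [hM, graphMat, Matrix.fromRows_mul, Matrix.fromRows_mul_fromCols, Matrix.fromBlocks_neg,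
      sub_eq_add_neg, Matrix.fromBlocks_neg, Matrix.fromBlocks_add]
    simp [Matrix.mul_assoc]
    abel
  have hsub : (Matrix.fromBlocks 0 (A * C⁻¹ * D - B) 0 0).submatrix K J -
      (graphMat (A * C⁻¹)).submatrix K id * C * (Matrix.fromCols 1 (C⁻¹ * D)).submatrix id J =
      -(M.submatrix K J) := by
    exact congrArg (fun Z : Matrix (Idx n) (Idx n) ℂ => Z.submatrix K J) key
  rw [borderedMinor, Matrix.det_fromBlocks₁₁]
  have hinv : ⅟(C⁻¹) = C := by
    rw [Matrix.invOf_eq_nonsing_inv, Matrix.nonsing_inv_nonsing_inv _ hCu]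
  rw [hinv]
  erw [hsub]
  rw [Matrix.det_neg, Matrix.det_nonsing_inv, Ring.inverse_eq_inv', Fintype.card_fin]
  have hs : ((-1 : ℂ) ^ (n + 1)) * (-1) ^ (n + 1) = 1 := by rw [← mul_pow]; simp
  field_simp
  linear_combination (-(M.submatrix K J).det) * hs

theorem continuous_borderedMinor (K J : Fin (n + 1) → Idx n) :
    Continuous fun q : Blk n × Blk n × Blk n × Blk n =>
      borderedMinor q.1 q.2.1 q.2.2.1 q.2.2.2 K J := by
  unfold borderedMinor graphMat
  refine Continuous.matrix_det ?_
  refine Continuous.matrix_fromBlocks (by fun_prop) ?_ ?_ ?_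
  · refine Continuous.matrix_submatrix ?_ _ _
    refine continuous_matrix fun i j => ?_
    rcases j with j | j
    · exact continuous_const
    · exact Continuous.matrix_elem (by fun_prop) i j
  · refine Continuous.matrix_submatrix ?_ _ _
    refine continuous_matrix fun i j => ?_
    rcases i with i | i
    · exact Continuous.matrix_elem (by fun_prop) i j
    · exact continuous_const
  · refine Continuous.matrix_submatrix ?_ _ _
    exact Continuous.matrix_fromBlocks (by fun_prop) (by fun_prop) (by fun_prop) (by fun_prop)

/-- The determinant of the swap of the two blocks. -/
def swapDet (n : ℕ) : ℂ :=
  (Matrix.fromBlocks (0 : Blk n) (1 : Blk n) (1 : Blk n) (0 : Blk n)).det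

theorem swapDet_ne_zero (n : ℕ) : swapDet n ≠ 0 := by
  intro h
  have : (Matrix.fromBlocks (0 : Blk n) (1 : Blk n) (1 : Blk n) (0 : Blk n) * Matrix.fromBlocks (0 : Blk n) (1 : Blk n) (1 : Blk n) (0 : Blk n)).det = 1 := by
    simp [Matrix.fromBlocks_multiply]
  rw [Matrix.det_mul] at this
  change swapDet n * swapDet n = 1 at this
  simp [h] at this

/-- In the limit the bordered matrix is block antidiagonal. Its determinant splits into a factor
depending on `K` and one depending on `J`, which is why limits of the induced maps have rank one. -/
theorem borderedMinor_zero (X Y : Blk n) (K J : Fin (n + 1) → Idx n) :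
    borderedMinor 0 X Y 0 K J = ((graphMat X).submatrix K id).det *
      (((Matrix.fromCols 1 Y).submatrix id J).det * swapDet n) := by
  have h : Matrix.fromBlocks 0 ((Matrix.fromCols 1 Y).submatrix id J)
      ((graphMat X).submatrix K id) ((Matrix.fromBlocks (0 : Blk n) 0 0 0).submatrix K J) =
      Matrix.fromBlocks ((Matrix.fromCols 1 Y).submatrix id J) 0 0
        ((graphMat X).submatrix K id) * Matrix.fromBlocks (0 : Blk n) (1 : Blk n) (1 : Blk n) (0 : Blk n) := by
    simp [Matrix.fromBlocks_multiply]
  rw [borderedMinor, h, Matrix.det_mul, Matrix.det_fromBlocks_zero₂₁, swapDet]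
  ring

/-- The multiindex of the coordinates `z'`. -/
def fstIdx (n : ℕ) : MultiIdx n := ⟨Sum.inl, fun _ _ h => Sum.Lex.inl_lt_inl_iff.2 h⟩

/-- The multiindex of the coordinates `z''`. -/
def sndIdx (n : ℕ) : MultiIdx n := ⟨Sum.inr, fun _ _ h => Sum.Lex.inr_lt_inr_iff.2 h⟩

theorem graphMat_sndIdx (X : Blk n) : (graphMat X).submatrix (sndIdx n).1 id = 1 := by
  ext i j; rfl

theorem fromCols_fstIdx (Y : Blk n) :
    (Matrix.fromCols (1 : Blk n) Y).submatrix id (fstIdx n).1 = 1 := by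
  ext i j; rfl

/-- The coordinate `i` of `z'`, together with all coordinates of `z''` but `k`. -/
def exchangeIdx (i k : Fin (n + 1)) : MultiIdx n :=
  ⟨Fin.cons (Sum.inl i) fun m => Sum.inr (k.succAbove m), by
    intro p q h
    induction p using Fin.cases with
    | zero =>
      induction q using Fin.cases with
      | zero => exact absurd h (lt_irrefl _)
      | succ q => exact Sum.Lex.inl_lt_inr _ _
    | succ p =>
      induction q using Fin.cases with
      | zero => exact absurd h (Fin.not_lt_zero _)
      | succ q =>
        refine Sum.Lex.inr_lt_inr_iff.2 ?_
        exact Fin.strictMono_succAbove k (Fin.succ_lt_succ_iff.1 h)⟩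

/-- The rows below the first are all unit vectors but the `k`-th, so expansion along the first row
leaves one term. -/
theorem det_graphMat_exchangeIdx (X : Blk n) (i k : Fin (n + 1)) :
    ((graphMat X).submatrix (exchangeIdx i k).1 id).det = (-1) ^ (k : ℕ) * X i k := by
  rw [Matrix.det_succ_row_zero, Finset.sum_eq_single k]
  · have : ((graphMat X).submatrix (exchangeIdx i k).1 id).submatrix Fin.succ k.succAbove = 1 := by
      ext p q
      simp [exchangeIdx, graphMat, Matrix.one_apply]
    rw [this, Matrix.det_one, mul_one]
    rfl
  · intro j _ hj
    obtain ⟨m, hm⟩ := Fin.exists_succAbove_eq hj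
    have : (((graphMat X).submatrix (exchangeIdx i k).1 id).submatrix Fin.succ j.succAbove).det =
        0 := by
      refine Matrix.det_eq_zero_of_row_eq_zero m fun q => ?_
      simp only [exchangeIdx, graphMat, Matrix.submatrix_apply, Fin.cons_succ,
        Matrix.fromRows_apply_inr, hm, id_eq]
      exact Matrix.one_apply_ne (Fin.succAbove_ne j q).symm
    rw [this, mul_zero]
  · simp

/-- The matrix `X` is determined by the Plücker coordinates of its graph. -/
theorem graphMat_inj {X X' : Blk n} (h : ∀ K : MultiIdx n,
    ((graphMat X).submatrix K.1 id).det = ((graphMat X').submatrix K.1 id).det) : X = X' := by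
  ext i k
  have := h (exchangeIdx i k)
  rw [det_graphMat_exchangeIdx, det_graphMat_exchangeIdx] at this
  exact mul_left_cancel₀ (pow_ne_zero _ (by norm_num)) this

theorem mul_graphMat_submatrix (X Z : Blk n) (K : Fin (n + 1) → Idx n) :
    (graphMat X * Z).submatrix K id = (graphMat X).submatrix K id * Z := rfl

/-- Linearly independent vectors have a non-zero Plücker coordinate. -/
theorem exists_pluecker_ne_zero {x : Fin (n + 1) → Idx n → ℂ} (hx : LinearIndependent ℂ x) :
    ∃ K, pluecker x K ≠ 0 := by
  set B : Matrix (Idx n) (Fin (n + 1)) ℂ := Matrix.of fun i j => x j i with hB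
  have hspan : Module.finrank ℂ (Submodule.span ℂ (Set.range B.row)) = n + 1 := by
    rw [← Matrix.rank_eq_finrank_span_row, ← Matrix.rank_transpose]
    have : LinearIndependent ℂ B.transpose.row := hx
    rw [this.rank_matrix, Fintype.card_fin]
  -- The row rank is `n + 1`, so there are `n + 1` independent rows; listed in increasing order they
  -- form a multiindex.
  obtain ⟨κ, a, ha, has, hal⟩ := exists_linearIndependent' ℂ B.row
  have : Finite κ := Finite.of_injective a ha
  cases nonempty_fintype κ
  have hcard : Fintype.card κ = n + 1 := by
    rw [← hspan, ← has]
    exact (finrank_span_eq_card hal).symm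
  set s : Finset (Lex (Idx n)) := Finset.univ.image fun k => toLex (a k)
  have hs : s.card = n + 1 := by
    rw [Finset.card_image_of_injective _ (fun p q h => ha (toLex.injective h)), Finset.card_univ,
      hcard]
  let e := s.orderEmbOfFin hs
  have hK : StrictMono fun k => toLex (ofLex (e k)) := fun p q h => e.strictMono h
  refine ⟨⟨fun k => ofLex (e k), hK⟩, ?_⟩
  have hmem : ∀ p, ∃ k, toLex (a k) = e p := fun p => by
    obtain ⟨k, -, hk⟩ := Finset.mem_image.1 (Finset.orderEmbOfFin_mem s hs p)
    exact ⟨k, hk⟩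
  choose f hf using hmem
  have hfinj : Function.Injective f := fun p q h => by
    apply e.injective
    have h1 := hf p
    have h2 := hf q
    rw [h] at h1
    exact h1.symm.trans h2
  have hli : LinearIndependent ℂ (B.submatrix (fun k => ofLex (e k)) id).row := by
    have heq : (B.submatrix (fun k => ofLex (e k)) id).row = (B.row ∘ a) ∘ f :=
      funext fun p => congrArg B (congrArg ofLex (hf p)).symm
    rw [heq]
    exact hal.comp f hfinj
  have := Matrix.linearIndependent_rows_iff_isUnit.1 hli
  rw [Matrix.isUnit_iff_isUnit_det, isUnit_iff_ne_zero] at this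
  exact this

/-- A plane whose Plücker coordinates are proportional to those of the graph of `X₀` is that
graph. -/
theorem fstPart_eq_of_pluecker {V : Submodule ℂ (Idx n → ℂ)} (b : Module.Basis (Fin (n + 1)) ℂ V)
    {X₀ : Blk n} {t : ℂ}
    (h : ∀ K, pluecker (fun j => (b j : Idx n → ℂ)) K = ((graphMat X₀).submatrix K.1 id).det * t)
    {v : Idx n → ℂ} (hv : v ∈ V) : fstPart v = X₀.mulVec (sndPart v) := by
  set x : Fin (n + 1) → Idx n → ℂ := fun j => (b j : Idx n → ℂ) with hx
  have hli : LinearIndependent ℂ x := b.linearIndependent.map' V.subtype V.ker_subtype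
  obtain ⟨K₀, hK₀⟩ := exists_pluecker_ne_zero hli
  have ht : t ≠ 0 := by
    rintro rfl
    exact hK₀ (by rw [h, mul_zero])
  set B : Matrix (Idx n) (Fin (n + 1)) ℂ := Matrix.of fun i j => x j i with hB
  have hp : ∀ K : MultiIdx n, (B.submatrix K.1 id).det = ((graphMat X₀).submatrix K.1 id).det * t :=
    h
  set B₂ := B.toRows₂ with hB₂
  -- The graph has Plücker coordinate `1` at the indices of `z''`, so the corresponding minor of the
  -- plane is `t ≠ 0`. The plane is therefore itself a graph, and `graphMat_inj` identifies it.
  have hd : B₂.det = t := by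
    have := hp (sndIdx n)
    rwa [graphMat_sndIdx, Matrix.det_one, one_mul] at this
  have hu : IsUnit B₂.det := by rw [hd]; exact isUnit_iff_ne_zero.2 ht
  set X := B.toRows₁ * B₂⁻¹ with hX
  have hXB : X * B₂ = B.toRows₁ := by
    rw [hX, Matrix.mul_assoc, Matrix.nonsing_inv_mul _ hu, Matrix.mul_one]
  have hBX : B = graphMat X * B₂ := by
    rw [graphMat, Matrix.fromRows_mul, hXB, Matrix.one_mul, hB₂, Matrix.fromRows_toRows]
  have hXX : X = X₀ := by
    refine graphMat_inj fun K => mul_right_cancel₀ ht ?_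
    rw [← hp K, ← hd, ← Matrix.det_mul, ← mul_graphMat_submatrix, ← hBX]
  set y := b.repr ⟨v, hv⟩
  have hvB : v = B.mulVec y := by
    have h1 := congrArg Subtype.val (b.sum_repr ⟨v, hv⟩)
    rw [Submodule.coe_sum] at h1
    conv_lhs => rw [show v = _ from h1.symm]
    ext i
    simp [Matrix.mulVec, dotProduct, hB, hx, mul_comm, y]
  have h1 : fstPart v = B.toRows₁.mulVec y := by rw [hvB]; rfl
  have h2 : sndPart v = B₂.mulVec y := by rw [hvB]; rfl
  rw [h1, h2, Matrix.mulVec_mulVec, ← hXX, hXB]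

end Minors

/-! ### Limit planes -/

section LimitPlanes

variable {n : ℕ} {R : ℝ} {Γ : Subgroup (PGLGroup n)}

theorem tendsto_of_opNorm {P : ℕ → Blk n} (h : Tendsto (fun ν => opNorm (P ν)) atTop (𝓝 0)) :
    Tendsto P atTop (𝓝 0) := by
  refine tendsto_pi_nhds.2 fun i => tendsto_pi_nhds.2 fun j => ?_
  exact squeeze_zero_norm (fun ν => norm_entry_le_opNorm (P ν) i j) h

theorem exists_subseq_tendsto {X Y : ℕ → Blk n} {R : ℝ}
    (hX : ∀ᶠ ν in atTop, opNorm (X ν) ≤ R) (hY : ∀ᶠ ν in atTop, opNorm (Y ν) ≤ R) :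
    ∃ X₀ Y₀ : Blk n, ∃ φ : ℕ → ℕ, StrictMono φ ∧ Tendsto (X ∘ φ) atTop (𝓝 X₀) ∧
      Tendsto (Y ∘ φ) atTop (𝓝 Y₀) := by
  set S : Set (Fin (n + 1) → Fin (n + 1) → ℂ) :=
    Set.univ.pi fun _ => Set.univ.pi fun _ => Metric.closedBall 0 R
  have hS : IsCompact S :=
    isCompact_univ_pi fun _ => isCompact_univ_pi fun _ => isCompact_closedBall _ _
  let q : ℕ → (Fin (n + 1) → Fin (n + 1) → ℂ) × (Fin (n + 1) → Fin (n + 1) → ℂ) :=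
    fun ν => (X ν, Y ν)
  have hmem : ∀ᶠ ν in atTop, q ν ∈ S ×ˢ S := by
    filter_upwards [hX, hY] with ν h1 h2
    refine ⟨fun i _ j _ => ?_, fun i _ j _ => ?_⟩
    · exact mem_closedBall_zero_iff.2 ((norm_entry_le_opNorm (X ν) i j).trans h1)
    · exact mem_closedBall_zero_iff.2 ((norm_entry_le_opNorm (Y ν) i j).trans h2)
  obtain ⟨⟨X₀, Y₀⟩, -, φ, hφ, h⟩ := (hS.prod hS).tendsto_subseq' hmem.frequently
  exact ⟨X₀, Y₀, φ, hφ, (continuous_fst.tendsto _).comp h, (continuous_snd.tendsto _).comp h⟩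

/-- By injectivity the sequence meets each of these finite sets, and also the identity, only
finitely often. -/
theorem tendsto_radius {f : ℕ → PGLGroup n} (hf : Function.Injective f) (hΓ : ∀ ν, f ν ∈ Γ)
    (hfin : ∀ ε : ℝ, 0 < ε → {g | g ∈ Γ ∧ g ≠ 1 ∧ ε ≤ radius g}.Finite) :
    Tendsto (fun ν => radius (f ν)) atTop (𝓝 0) := by
  rw [← Nat.cofinite_eq_atTop]
  refine Metric.tendsto_nhds.2 fun ε hε => ?_
  have hS := (hfin ε hε).union (Set.finite_singleton (1 : PGLGroup n))
  filter_upwards [hf.tendsto_cofinite hS.compl_mem_cofinite] with ν hν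
  have h0 : 0 ≤ radius (f ν) := opNorm_nonneg _
  rw [Real.dist_eq, sub_zero, abs_of_nonneg h0]
  by_contra! hle
  refine hν ?_
  by_cases h1 : f ν = 1
  · exact Or.inr h1
  · exact Or.inl ⟨hΓ ν, h1, hle⟩

theorem opNorm_le_of_tendsto {X : ℕ → Blk n} {X₀ : Blk n} (h : Tendsto X atTop (𝓝 X₀)) {R : ℝ}
    (hX : ∀ᶠ ν in atTop, opNorm (X ν) ≤ R) (hR : 0 ≤ R) : opNorm X₀ ≤ R := by
  refine opNorm_le hR fun u => ?_
  have hc : Continuous fun Z : Blk n => vnorm (Z.mulVec u) :=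
    continuous_vnorm.comp (continuous_id.matrix_mulVec continuous_const)
  refine le_of_tendsto ((hc.tendsto _).comp h) ?_
  filter_upwards [hX] with ν hν
  exact (vnorm_mulVec_le _ _).trans (mul_le_mul_of_nonneg_right hν (vnorm_nonneg _))

/-- The block equations of `M * M⁻¹ = 1` show that `B - AC⁻¹D` is a left inverse of the lower left
block of `M⁻¹`. Hence this quantity too tends to `0` along distinct elements. -/
theorem opNorm_schur {M : Matrix (Idx n) (Idx n) ℂ} {g : PGLGroup n} (hM : IsRep M g)
    (hC : M.toBlocks₂₁.det ≠ 0) :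
    opNorm (M.toBlocks₁₁ * M.toBlocks₂₁⁻¹ * M.toBlocks₂₂ - M.toBlocks₁₂) = radius g⁻¹ := by
  have hMM : M * M⁻¹ = 1 := Matrix.mul_nonsing_inv _ hM.isUnit_det
  have h1 : M.toBlocks₁₁ * M⁻¹.toBlocks₁₁ + M.toBlocks₁₂ * M⁻¹.toBlocks₂₁ = 1 := by
    rw [← mul_toBlocks₁₁, hMM, ← Matrix.fromBlocks_one, Matrix.toBlocks_fromBlocks₁₁]
  have h2 : M.toBlocks₂₁ * M⁻¹.toBlocks₁₁ + M.toBlocks₂₂ * M⁻¹.toBlocks₂₁ = 0 := by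
    rw [← mul_toBlocks₂₁, hMM, ← Matrix.fromBlocks_one, Matrix.toBlocks_fromBlocks₂₁]
  have h3 : M.toBlocks₁₁ * M.toBlocks₂₁⁻¹ * (M.toBlocks₂₁ * M⁻¹.toBlocks₁₁) =
      M.toBlocks₁₁ * M⁻¹.toBlocks₁₁ := by
    rw [Matrix.mul_assoc, ← Matrix.mul_assoc M.toBlocks₂₁⁻¹,
      Matrix.nonsing_inv_mul _ (isUnit_iff_ne_zero.2 hC), Matrix.one_mul]
  rw [hM.inv.radius_eq, ← opNorm_neg]
  congr 1
  refine (Matrix.inv_eq_left_inv ?_).symm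
  rw [Matrix.neg_mul, Matrix.sub_mul, Matrix.mul_assoc _ M.toBlocks₂₂, eq_neg_of_add_eq_zero_right h2,
    Matrix.mul_neg, h3, ← h1]
  abel

/-- The limits of the induced maps on `(n+1)`-vectors have rank one, with image the Plücker point of
the graph `z' = X₀ z''` of a bounded matrix `X₀`. -/
theorem exists_graph_of_normalizedLimit (hR : 0 ≤ R)
    (hmv : ∀ g ∈ Γ, g ≠ 1 → ∀ M, IsRep M g → MovesTube R M)
    (hfin : ∀ ε : ℝ, 0 < ε → {g | g ∈ Γ ∧ g ≠ 1 ∧ ε ≤ radius g}.Finite)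
    {s : ℕ → Matrix.GeneralLinearGroup (Idx n) ℂ}
    (hs : ∀ ν, Matrix.ProjGenLinGroup.mk (s ν) ∈ Γ)
    (hinj : Function.Injective fun ν => Matrix.ProjGenLinGroup.mk (s ν))
    {S : Matrix (MultiIdx n) (MultiIdx n) ℂ}
    (hS : NormalizedLimit (fun ν => compound (s ν : Matrix (Idx n) (Idx n) ℂ)) S) :
    ∃ X₀ : Blk n, opNorm X₀ ≤ R ∧ ∃ a : MultiIdx n → ℂ, ∀ K J,
      S K J = ((graphMat X₀).submatrix K.1 id).det * a J := by
  obtain ⟨c, -, hc⟩ := hS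
  set f : ℕ → PGLGroup n := fun ν => Matrix.ProjGenLinGroup.mk (s ν)
  set M : ℕ → Matrix (Idx n) (Idx n) ℂ := fun ν => slRep (f ν)
  have hM : ∀ ν, IsRep (M ν) (f ν) := fun ν => isRep_slRep _
  have hd : ∀ ν, ∃ d : ℂ, (s ν : Matrix (Idx n) (Idx n) ℂ) = d • M ν := by
    intro ν
    obtain ⟨-, u, hu, huf⟩ := hM ν
    obtain ⟨d, hd⟩ := Matrix.ProjGenLinGroup.mk_eq_mk_iff.1 huf
    refine ⟨d, ?_⟩
    rw [← hu, ← hd]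
    simp [← Matrix.smul_one_eq_diagonal]
  choose d hd using hd
  have hne : ∀ᶠ ν in atTop, f ν ≠ 1 := by
    rw [← Nat.cofinite_eq_atTop]
    exact hinj.tendsto_cofinite (Set.finite_singleton (1 : PGLGroup n)).compl_mem_cofinite
  set P : ℕ → Blk n := fun ν => (M ν).toBlocks₂₁⁻¹
  set X : ℕ → Blk n := fun ν => (M ν).toBlocks₁₁ * (M ν).toBlocks₂₁⁻¹
  set Y : ℕ → Blk n := fun ν => (M ν).toBlocks₂₁⁻¹ * (M ν).toBlocks₂₂
  set E : ℕ → Blk n := fun ν =>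
    (M ν).toBlocks₁₁ * (M ν).toBlocks₂₁⁻¹ * (M ν).toBlocks₂₂ - (M ν).toBlocks₁₂
  have hC : ∀ᶠ ν in atTop, (M ν).toBlocks₂₁.det ≠ 0 := by
    filter_upwards [hne] with ν hν
    exact (hmv _ (hs ν) hν _ (hM ν)).det_ne_zero (hM ν)
  have hX : ∀ᶠ ν in atTop, opNorm (X ν) ≤ R := by
    filter_upwards [hne] with ν hν
    exact opNorm_le hR ((hmv _ (hs ν) hν _ (hM ν)).vnorm_mul_inv_le (hM ν))
  have hY : ∀ᶠ ν in atTop, opNorm (Y ν) ≤ R := by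
    filter_upwards [hne] with ν hν
    exact opNorm_le hR ((hmv _ (hs ν) hν _ (hM ν)).vnorm_inv_mul_le (hM ν))
  have hP : Tendsto P atTop (𝓝 0) := tendsto_of_opNorm (tendsto_radius hinj hs hfin)
  have hE : Tendsto E atTop (𝓝 0) := by
    refine tendsto_of_opNorm ((tendsto_radius (f := fun ν => (f ν)⁻¹)
      (fun _ _ h => hinj (inv_injective h)) (fun ν => inv_mem (hs ν)) hfin).congr' ?_)
    filter_upwards [hC] with ν hν
    exact (opNorm_schur (hM ν) hν).symm
  -- Passing to a subsequence is harmless, since the normalized induced maps converge to `S` anyway.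
  obtain ⟨X₀, Y₀, φ, hφ, hX₀, hY₀⟩ := exists_subseq_tendsto hX hY
  refine ⟨X₀, opNorm_le_of_tendsto hX₀ (hφ.tendsto_atTop.eventually hX) hR, ?_⟩
  set m : ℕ → MultiIdx n → MultiIdx n → ℂ := fun ν K J =>
    borderedMinor (P (φ ν)) (X (φ ν)) (Y (φ ν)) (E (φ ν)) K.1 J.1
  have hm : ∀ K J : MultiIdx n, Tendsto (fun ν => m ν K J) atTop
      (𝓝 (((graphMat X₀).submatrix K.1 id).det *
        (((Matrix.fromCols 1 Y₀).submatrix id J.1).det * swapDet n))) := by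
    intro K J
    rw [← borderedMinor_zero]
    have hq := (hP.comp hφ.tendsto_atTop).prodMk_nhds
      (hX₀.prodMk_nhds (hY₀.prodMk_nhds (hE.comp hφ.tendsto_atTop)))
    exact ((continuous_borderedMinor K.1 J.1).tendsto _).comp hq
  set e : ℕ → ℂ := fun ν => c (φ ν) * d (φ ν) ^ (n + 1) *
    ((-1) ^ (n + 1) * (M (φ ν)).toBlocks₂₁.det)
  have hcm : ∀ K J : MultiIdx n, Tendsto (fun ν => e ν * m ν K J) atTop (𝓝 (S K J)) := by
    intro K J
    have h1 := (tendsto_pi_nhds.1 (tendsto_pi_nhds.1 hc K) J).comp hφ.tendsto_atTop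
    refine h1.congr' ?_
    filter_upwards [hφ.tendsto_atTop.eventually hC] with ν hν
    change c (φ ν) * ((s (φ ν) : Matrix (Idx n) (Idx n) ℂ).submatrix K.1 J.1).det = _
    have h2 : ((s (φ ν) : Matrix (Idx n) (Idx n) ℂ).submatrix K.1 J.1) =
        d (φ ν) • (M (φ ν)).submatrix K.1 J.1 := by
      rw [hd]; rfl
    rw [h2, Matrix.det_smul, Fintype.card_fin, det_submatrix_eq hν]
    simp only [e, m, P, X, Y, E]
    ring
  have hm₀ := hm (sndIdx n) (fstIdx n)
  rw [graphMat_sndIdx, fromCols_fstIdx, Matrix.det_one, one_mul, one_mul] at hm₀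
  have hne₀ : ∀ᶠ ν in atTop, m ν (sndIdx n) (fstIdx n) ≠ 0 :=
    hm₀.eventually_ne (swapDet_ne_zero n)
  -- The bordered minor at the rows `z''` and columns `z'` tends to `swapDet n ≠ 0`, so dividing by
  -- it shows that the scalar factors converge.
  have he : Tendsto e atTop (𝓝 (S (sndIdx n) (fstIdx n) / swapDet n)) := by
    refine ((hcm (sndIdx n) (fstIdx n)).div hm₀ (swapDet_ne_zero n)).congr' ?_
    filter_upwards [hne₀] with ν hν
    exact mul_div_cancel_right₀ _ hν
  refine ⟨fun J => S (sndIdx n) (fstIdx n) / swapDet n *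
    (((Matrix.fromCols 1 Y₀).submatrix id J.1).det * swapDet n), fun K J => ?_⟩
  rw [tendsto_nhds_unique (hcm K J) (he.mul (hm K J))]
  ring

/-- The limit planes do not meet a tube that is moved off itself. -/
theorem tube_subset_discontinuitySet (hR : 0 ≤ R)
    (hmv : ∀ g ∈ Γ, g ≠ 1 → ∀ M, IsRep M g → MovesTube R M)
    (hfin : ∀ ε : ℝ, 0 < ε → {g | g ∈ Γ ∧ g ≠ 1 ∧ ε ≤ radius g}.Finite) :
    tube R ⊆ discontinuitySet Γ := by
  intro p hp hlim
  obtain ⟨V, ⟨s, hs, hinj, -, S, hS, b, q, hq⟩, hpV⟩ := Set.mem_iUnion₂.1 hlim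
  obtain ⟨X₀, hX₀, a, ha⟩ := exists_graph_of_normalizedLimit hR hmv hfin hs hinj hS
  induction p using Projectivization.ind with | h v hv =>
  have hpV : (Projectivization.mk ℂ v hv).submodule ≤ V := hpV
  rw [Projectivization.submodule_mk, Submodule.span_singleton_le_iff_mem] at hpV
  rw [mk_mem_tube_iff] at hp
  have h := fstPart_eq_of_pluecker b (X₀ := X₀) (t := ∑ J, a J * q J) (fun K => by
    rw [← hq, Finset.mul_sum]
    change ∑ J, S K J * q J = _
    exact Finset.sum_congr rfl fun J _ => by rw [ha]; ring) hpV
  rw [h] at hp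
  exact hp.not_ge ((vnorm_mulVec_le _ _).trans
    (mul_le_mul_of_nonneg_right hX₀ (vnorm_nonneg _)))

end LimitPlanes

end TypeLGroup

end

open TypeLGroup
theorem theorem6p1 (n : ℕ) (hn : 1 ≤ n) (Γ₁ Γ₂ : Subgroup (PGLGroup n))
    (hL₁ : IsTypeL Γ₁) (hL₂ : IsTypeL Γ₂)
    (hadm₁ : AdmissibleCoordinates Γ₁) (hadm₂ : AdmissibleCoordinates Γ₂)
    (hclub₁ : Club Γ₁) (hclub₂ : Club Γ₂)
    (hspade₁ : Spade Γ₁) (hspade₂ : Spade Γ₂) :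
    -- suitable parameters exist
    Tendsto (combConst n) (𝓝[>] 0) (𝓝 2⁻¹) ∧
    (∀ r : ℝ, 0 < r → ∃ (a : ℝ) (ha : 0 < a), Suitable Γ₁ Γ₂ r a ha) ∧
    -- and every suitable choice of them has the asserted properties
    ∀ r : ℝ, 0 < r → r < 1 → ∀ (a : ℝ) (ha : 0 < a), Suitable Γ₁ Γ₂ r a ha →
      IsInternalFreeProduct (firstFactor Γ₁ a ha) (secondFactor Γ₂ a ha)
        (firstFactor Γ₁ a ha ⊔ secondFactor Γ₂ a ha) ∧
      (∀ l : List (PGLGroup n), IsNormalForm (firstFactor Γ₁ a ha) (secondFactor Γ₂ a ha) l →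
        (∀ g ∈ l, (blockC g).det ≠ 0) ∧ (blockC l.prod).det ≠ 0 ∧
        radius l.prod ≤ combConst n r ^ (l.length - 1) * (l.map radius).prod) ∧
      (combConst n r < 1 →
        IsTypeL (firstFactor Γ₁ a ha ⊔ secondFactor Γ₂ a ha) ∧
        AdmissibleCoordinates (firstFactor Γ₁ a ha ⊔ secondFactor Γ₂ a ha) ∧
        Club (firstFactor Γ₁ a ha ⊔ secondFactor Γ₂ a ha) ∧
        Spade (firstFactor Γ₁ a ha ⊔ secondFactor Γ₂ a ha)) := by
  refine ⟨tendsto_combConst n,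
    fun r hr => exists_suitable hadm₁ hadm₂ hclub₁ hclub₂ hr, fun r hr0 hr a ha hs => ?_⟩
  obtain ⟨size, hS⟩ := exists_isLetterSystem hadm₁ hadm₂ hclub₁ hclub₂ hspade₁ hspade₂ hr0 ha hs
  -- The block `C` of a word is invertible, whereas that of the identity is `0`.
  refine ⟨isInternalFreeProduct_of_word fun b l hl =>
    ne_one_of_det_blockC_ne_zero (hS.det_ne_zero hr0 hr hl), fun l hl => ?_, fun hK => ?_⟩
  · obtain ⟨b, hb⟩ := hl.exists_word (H := fun b => cond b (firstFactor Γ₁ a ha)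
      (secondFactor Γ₂ a ha)) (hS.eq_one_of_mem hr)
    refine ⟨fun g hg => ?_, hS.det_ne_zero hr0 hr hb, hS.radius_prod_le hr0 hr hb⟩
    obtain ⟨hg1, hg | hg⟩ := hl.2.1 g hg
    · simpa using hS.det_ne_zero hr0 hr (Word.single (b := true) hg hg1)
    · simpa using hS.det_ne_zero hr0 hr (Word.single (b := false) hg hg1)
  -- The tube of radius `(1 + r)/(1 - r)` serves three purposes: it shows discreteness, it is the
  -- large domain, and it makes the coordinates admissible.
  · have hrr := lt_of_combConst_lt_one hr0.le hr hK
    have hR : 0 < (1 + r) / (1 - r) := div_pos (by linarith) (by linarith)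
    have hfin : ∀ ε : ℝ, 0 < ε → {g | g ∈ firstFactor Γ₁ a ha ⊔ secondFactor Γ₂ a ha ∧ g ≠ 1 ∧
        ε ≤ radius g}.Finite := fun ε hε => hS.finite_le_radius hr0 hr hrr hε
    have hmv : ∀ g ∈ firstFactor Γ₁ a ha ⊔ secondFactor Γ₂ a ha, g ≠ 1 → ∀ M, IsRep M g →
        MovesTube ((1 + r) / (1 - r)) M := fun g hg hg1 M hM => hS.movesTube hr0 hr hg hg1 hM
    have hdisj := fun g hg hg1 => (isRep_slRep g).disjoint_tube_iff.2 (hmv g hg hg1 _ (isRep_slRep g))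
    have hΩ := tube_subset_discontinuitySet hR.le hmv hfin
    exact ⟨⟨discreteTopology_of_disjoint hdisj, _, isLargeDomain_tube n hR, hΩ⟩,
      ⟨_, hR, hΩ, hdisj⟩, hS.club hr0 hr hrr, spade_of_finite hfin⟩
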